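/- For a finite hypergraph $\mathcal H$ with vertex set $V$ and a real $p\in(0,1]$, let $w_p(\mathcal H)=\sum_{E}p^{|E|}$ (sum over all edges), $\bar w_p(\mathcal H)=w_p(\mathcal H)/|V|$, and $\Delta_{i,p}(\mathcal H)=\max_{L\subseteq V,\,|L|=i}\sum_{E\supseteq L}p^{|E|}$. Call $\mathcal H$ a $(\lambda,p)_k$-structure if every edge has at most $k$ vertices, $\bar w_p(\mathcal H)\ge p$, $\Delta_{1,p}(\mathcal H)\le\lambda\,\bar w_p(\mathcal H)$ and $\Delta_{2,p}(\mathcal H)\le\lambda\,\bar w_p(\mathcal H)\,p^k$. A $k$-SAT formula $\varphi$ in the variables $x_1,\dots,x_n$ is a finite set of clauses, each of which is a set of exactly $k$ literals. Its hypergraph $\mathcal H_\varphi$ has the $2n$ literals as vertices and the sets $\{\neg\ell:\ell\in K\}$, for $K$ a clause of $\varphi$, as edges; $\varphi$ is called a $(\lambda,p)_k$-structure if $\mathcal H_\varphi$ is one. **Theorem 1.3.** For every integer $k>1$ and all reals $\lambda>1$, $0<\delta<1/4$ and $\varepsilon>0$ there are $p'\in(0,1]$, a deterministic algorithm $A$ and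 a polynomial $q$ (all depending only on $k,\lambda,\delta,\varepsilon$) such that the following holds for every $0<p<p'$, every $n$ and every $k$-SAT formula $\varphi$ in $n$ variables that is a $(\lambda,p)_k$-structure. On input $\varphi$ (its clauses, and the literals within each clause, listed without repetition in any order, with $n$ given), $A$ halts after at most $q(n)\,2^{\varepsilon n}$ steps, that is, in time $O^*(2^{\varepsilon n})$, with one of the following two outcomes: * it reports that $\varphi$ is unsatisfiable, and $\varphi$ indeed has no satisfying assignment; or * it outputs an assignment that satisfies at least a $(1-\delta)$ fraction of the clauses of $\varphi$. Here algorithms are programs on binary trees (cons cells), with unit cost for each of: building the empty tree, forming a cell, taking a component of a cell, testing for emptiness, branching, and a loop iteration. -/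

import Mathlib

namespace SpreadSAT

section Hypergraphs

/-- A finite hypergraph with vertex set all of `V`, given by its set of edges. -/
structure FinHypergraph (V : Type*) where
  /-- the edges, a set of finite sets of vertices -/
  edges : Finset (Finset V)

variable {V : Type*} [Fintype V] [DecidableEq V]

/-- The `p`-weight of a family of edges: the sum of `p ^ |E|` over its members `E`. -/
noncomputable def pWeight (p : ℝ) (𝓕 : Finset (Finset V)) : ℝ :=
  ∑ E ∈ 𝓕, p ^ E.card

/-- The average `p`-weight `w_p(H) / |V(H)|`. -/
noncomputable def avgWeight (p : ℝ) (H : FinHypergraph V) : ℝ :=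
  pWeight p H.edges / Fintype.card V

/-- The maximal `p`-codegree of `i`-sets: the maximum over all vertex sets `L` of size `i` of the
`p`-weight of the family of edges containing `L`. (The index type is finite, so that the supremum
is a maximum whenever `V` has at least `i` elements.) -/
noncomputable def maxCodegree (i : ℕ) (p : ℝ) (H : FinHypergraph V) : ℝ :=
  ⨆ L : {L : Finset V // L.card = i}, pWeight p (H.edges.filter fun E => L.1 ⊆ E)

/-- `(lam, p)_k`-structures. -/
structure IsSpreadStructure (lam p : ℝ) (k : ℕ) (H : FinHypergraph V) : Prop where
  /-- `H` is `k`-bounded -/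
  bounded : ∀ E ∈ H.edges, E.card ≤ k
  avg_ge : p ≤ avgWeight p H
  codegree_one_le : maxCodegree 1 p H ≤ lam * avgWeight p H
  codegree_two_le : maxCodegree 2 p H ≤ lam * avgWeight p H * p ^ k

end Hypergraphs

section Formulas

/-- Literals over the variables `x_i`, `i : Fin n`: `(i, true)` is `x_i`, `(i, false)` is `¬ x_i`. -/
abbrev Literal (n : ℕ) : Type := Fin n × Bool

/-- The negation of a literal. -/
def Literal.neg {n : ℕ} (l : Literal n) : Literal n := (l.1, !l.2)

/-- A clause: the disjunction of a finite set of literals. -/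
abbrev Clause (n : ℕ) : Type := Finset (Literal n)

/-- A CNF formula in `n` variables: the conjunction of a finite set of clauses. -/
abbrev CNF (n : ℕ) : Type := Finset (Clause n)

variable {n : ℕ}

/-- Every clause has exactly `k` literals. -/
def IsKSAT (k : ℕ) (φ : CNF n) : Prop := ∀ K ∈ φ, K.card = k

/-- The assignment `a` makes some literal of the clause `K` true. -/
def SatisfiesClause (a : Fin n → Bool) (K : Clause n) : Prop := ∃ l ∈ K, a l.1 = l.2

instance (a : Fin n → Bool) (K : Clause n) : Decidable (SatisfiesClause a K) :=
  inferInstanceAs (Decidable (∃ l ∈ K, a l.1 = l.2))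

/-- Some assignment satisfies every clause of the formula. -/
def Satisfiable (φ : CNF n) : Prop := ∃ a : Fin n → Bool, ∀ K ∈ φ, SatisfiesClause a K

/-- The number of clauses of the formula that the assignment satisfies. -/
def numSatisfied (a : Fin n → Bool) (φ : CNF n) : ℕ := (φ.filter (SatisfiesClause a)).card

/-- The hypergraph of a formula: its vertices are all `2 n` literals, and its edges are the sets
`{¬ l : l ∈ K}`, where `K` is a clause. -/
def CNF.hypergraph (φ : CNF n) : FinHypergraph (Literal n) where
  edges := φ.image fun K => K.image Literal.neg

end Formulas

/-! ### The machine model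

Programs compute on binary trees ("cons cells"), as in pure Lisp or the WHILE language of
N. Jones. The elementary operations are: build the empty tree, form a cons cell from two
values, take the left or the right component of a cell, test for emptiness, branch, and loop.
Each costs one unit. There is no arithmetic and no equality test on whole trees, so that the running
time is polynomially related to that of Turing machines. -/

section Machine

/-- Binary trees. -/
inductive Data : Type
  /-- the empty tree -/
  | nil : Data
  /-- a cell with two components -/
  | cons : Data → Data → Data

/-- The left component (`nil` for the empty tree). -/
def Data.head : Data → Data
  | .nil => .nil
  | .cons x _ => x

/-- The right component (`nil` for the empty tree). -/
def Data.tail : Data → Data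
  | .nil => .nil
  | .cons _ y => y

/-- Programs. A program turns one input tree into one output tree. -/
inductive Prog : Type
  /-- return the input -/
  | skip : Prog
  /-- return the empty tree -/
  | nil : Prog
  /-- return the left component of the input -/
  | head : Prog
  /-- return the right component of the input -/
  | tail : Prog
  /-- run both programs on the input and form a cell from the two results -/
  | pair : Prog → Prog → Prog
  /-- run the first program, then run the second one on its result -/
  | seq : Prog → Prog → Prog
  /-- run the first program on the input; if the result is a cell, run the second program on
  the input, and otherwise the third one -/
  | cond : Prog → Prog → Prog → Prog
  /-- `loop c f`: as long as `c`, run on the current value, returns a cell, replace the current value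
  by the result of `f` on it -/
  | loop : Prog → Prog → Prog

/-- `Runs P x y t`: the program `P`, started on the input `x`, halts with the output `y` after
exactly `t` elementary steps. -/
inductive Prog.Runs : Prog → Data → Data → ℕ → Prop
  | skip (x : Data) : Runs .skip x x 1
  | nil (x : Data) : Runs .nil x .nil 1
  | head (x : Data) : Runs .head x x.head 1
  | tail (x : Data) : Runs .tail x x.tail 1
  | pair {f g : Prog} {x y z : Data} {s t : ℕ} :
      Runs f x y s → Runs g x z t → Runs (.pair f g) x (.cons y z) (s + t + 1)
  | seq {f g : Prog} {x y z : Data} {s t : ℕ} :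
      Runs f x y s → Runs g y z t → Runs (.seq f g) x z (s + t + 1)
  | cond_cons {c f g : Prog} {x u v z : Data} {s t : ℕ} :
      Runs c x (.cons u v) s → Runs f x z t → Runs (.cond c f g) x z (s + t + 1)
  | cond_nil {c f g : Prog} {x z : Data} {s t : ℕ} :
      Runs c x .nil s → Runs g x z t → Runs (.cond c f g) x z (s + t + 1)
  | loop_cons {c f : Prog} {x u v y z : Data} {s t r : ℕ} :
      Runs c x (.cons u v) s → Runs f x y t → Runs (.loop c f) y z r →
        Runs (.loop c f) x z (s + t + r + 1)
  | loop_nil {c f : Prog} {x : Data} {s : ℕ} :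
      Runs c x .nil s → Runs (.loop c f) x x (s + 1)

/-- The model is deterministic: the output and the number of steps are determined by the program
and its input. -/
theorem Prog.Runs.unique {P : Prog} {x y : Data} {s : ℕ} (h : P.Runs x y s) :
    ∀ {z : Data} {t : ℕ}, P.Runs x z t → y = z ∧ s = t := by
  induction h with
  | skip | nil | head | tail => intro z t h'; cases h'; exact ⟨rfl, rfl⟩
  | pair _ _ ih₁ ih₂ =>
    intro z t h'
    cases h' with
    | pair h₁ h₂ =>
      obtain ⟨rfl, rfl⟩ := ih₁ h₁
      obtain ⟨rfl, rfl⟩ := ih₂ h₂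
      exact ⟨rfl, rfl⟩
  | seq _ _ ih₁ ih₂ =>
    intro z t h'
    cases h' with
    | seq h₁ h₂ =>
      obtain ⟨rfl, rfl⟩ := ih₁ h₁
      obtain ⟨rfl, rfl⟩ := ih₂ h₂
      exact ⟨rfl, rfl⟩
  | cond_cons _ _ ih₁ ih₂ =>
    intro z t h'
    cases h' with
    | cond_cons h₁ h₂ =>
      obtain ⟨_, rfl⟩ := ih₁ h₁
      obtain ⟨rfl, rfl⟩ := ih₂ h₂
      exact ⟨rfl, rfl⟩
    | cond_nil h₁ h₂ => exact absurd (ih₁ h₁).1 (by simp)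
  | cond_nil _ _ ih₁ ih₂ =>
    intro z t h'
    cases h' with
    | cond_cons h₁ h₂ => exact absurd (ih₁ h₁).1 (by simp)
    | cond_nil h₁ h₂ =>
      obtain ⟨_, rfl⟩ := ih₁ h₁
      obtain ⟨rfl, rfl⟩ := ih₂ h₂
      exact ⟨rfl, rfl⟩
  | loop_cons _ _ _ ih₁ ih₂ ih₃ =>
    intro z t h'
    cases h' with
    | loop_cons h₁ h₂ h₃ =>
      obtain ⟨_, rfl⟩ := ih₁ h₁
      obtain ⟨rfl, rfl⟩ := ih₂ h₂
      obtain ⟨rfl, rfl⟩ := ih₃ h₃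
      exact ⟨rfl, rfl⟩
    | loop_nil h₁ => exact absurd (ih₁ h₁).1 (by simp)
  | loop_nil _ ih₁ =>
    intro z t h'
    cases h' with
    | loop_cons h₁ h₂ h₃ => exact absurd (ih₁ h₁).1 (by simp)
    | loop_nil h₁ =>
      obtain ⟨_, rfl⟩ := ih₁ h₁
      exact ⟨rfl, rfl⟩

end Machine

section Encodings

/-- Lists as right combs of cells. -/
def encodeList : List Data → Data
  | [] => .nil
  | x :: xs => .cons x (encodeList xs)

/-- Natural numbers in unary notation. -/
def encodeNat (m : ℕ) : Data := encodeList (List.replicate m .nil)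

/-- Truth values. -/
def encodeBool : Bool → Data
  | false => .nil
  | true => .cons .nil .nil

variable {n : ℕ}

/-- A literal is encoded by its sign and the index of its variable. -/
def encodeLiteral (l : Literal n) : Data := .cons (encodeBool l.2) (encodeNat l.1)

/-- The input tree for a formula in `n` variables that is written as a list of clauses, each
written as a list of literals: the number `n`, followed by the clauses. -/
def encodeFormula (F : List (List (Literal n))) : Data :=
  .cons (encodeNat n) (encodeList (F.map fun K => encodeList (K.map encodeLiteral)))

/-- `F` is a way to write down the formula `φ`: it lists the clauses of `φ` in some order and
without repetition, and within each clause its literals in some order and without repetition. -/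
def Writes (F : List (List (Literal n))) (φ : CNF n) : Prop :=
  (∀ K ∈ F, K.Nodup) ∧ (F.map List.toFinset).Nodup ∧ (F.map List.toFinset).toFinset = φ

/-- The output tree: `nil` for the answer "unsatisfiable" (`none`), and otherwise a cell that holds
the list of the values that the assignment found gives to `x_1, …, x_n`. -/
def encodeOutcome : Option (Fin n → Bool) → Data
  | none => .nil
  | some a => .cons .nil (encodeList (List.ofFn fun i => encodeBool (a i)))

/-- The two admissible outcomes: the answer "unsatisfiable", given for an unsatisfiable formula only,
or an assignment that satisfies at least a `1 - δ` fraction of the clauses. -/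
def IsCorrectOutcome (δ : ℝ) (φ : CNF n) : Option (Fin n → Bool) → Prop
  | none => ¬ Satisfiable φ
  | some a => (1 - δ) * φ.card ≤ numSatisfied a φ

end Encodings

end SpreadSAT

open SpreadSAT

/-! The proof is a container argument. Let `a` satisfy the formula and let `I` be the set of
literals that `a` makes false. Every clause contains a literal outside `I`, so `I` is independent in
the hypergraph of clauses. (Working with the clauses instead of the negated edges only flips the
roles of the literals.) It is enough to find a set `X` of literals outside `I` that meets all but a
`1 / D` fraction of the clauses, where `1 / δ ≤ D`: such literals are all true under `a`, hence
consistent, and can be made true together.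

The procedure builds `X` by asking whether heavy vertices `v` belong to `I`. On a no, `v` joins `X`
and its clauses are done. On a yes, `v` is deleted from its eligible clauses, which still contain a
vertex outside `I`. A clause is eligible only if its other vertices are unsaturated one level below;
the codegree condition then keeps every degree below its threshold throughout (`Spread.removeFrom`).
When no vertex is heavy any more, an induction over clause sizes shows that few clauses are left
(`Spread.count_level`, `Spread.count_le`).

Few answers are yes. Give a clause of size `j` the weight `K ^ (k - j)`. A yes raises the total
weight substantially, a no lowers it by a bounded amount, there are at most `2n` noes, and the final
weight is bounded by the degrees. So the set `G` of vertices with answer yes satisfies `B |G| ≤ n`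
(`Reachable.card_mul_le`), where `B` can be as large as desired at the cost of a larger `K`, that
is, of a smaller `p'`. Moreover `G` determines the whole run (`Reachable.exists_run`); together this
is `exists_fingerprint`.

The algorithm does not know `I`. It runs the procedure with each `G` such that `B |G| ≤ n` as the
oracle, and tests the resulting assignment directly. An assignment that it outputs is therefore good
for any `G`, and if all of them fail then the formula has no satisfying assignment
(`exists_attempt`). By a generating function estimate there are at most `2 ^ (ε n)` sets `G`
(`exists_price`).

For the running time, functions on encoded data are shown to be polynomial time by closure
properties (`PolyTime`). The list of all `G` is too long for that, so the two outer loops are timed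
by hand, as a polynomial times the number of sets (`exists_choices_prog`, `exists_solve_prog`). -/

namespace SpreadSAT

/-! ### Running times -/

/-- The number of nodes of a tree. -/
def Data.size : Data → ℕ
  | .nil => 1
  | .cons x y => x.size + y.size + 1

/-- `P`, started on `x`, halts with output `y` after at most `T` steps. -/
def Prog.RunsIn (P : Prog) (x y : Data) (T : ℕ) : Prop := ∃ t ≤ T, P.Runs x y t

namespace Prog.RunsIn

variable {f g c : Prog} {x y z u v : Data} {s t r T : ℕ}

theorem mono (h : Prog.RunsIn f x y s) (hst : s ≤ t) : Prog.RunsIn f x y t :=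
  let ⟨r, hr, h'⟩ := h
  ⟨r, hr.trans hst, h'⟩

theorem skip : Prog.RunsIn .skip x x 1 := ⟨1, le_rfl, .skip x⟩

theorem nil : Prog.RunsIn .nil x .nil 1 := ⟨1, le_rfl, .nil x⟩

theorem head : Prog.RunsIn .head x x.head 1 := ⟨1, le_rfl, .head x⟩

theorem tail : Prog.RunsIn .tail x x.tail 1 := ⟨1, le_rfl, .tail x⟩

theorem pair (hf : f.RunsIn x y s) (hg : g.RunsIn x z t) :
    (Prog.pair f g).RunsIn x (.cons y z) (s + t + 1) :=
  let ⟨_, h₁, hf⟩ := hf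
  let ⟨_, h₂, hg⟩ := hg
  ⟨_, by omega, .pair hf hg⟩

theorem seq (hf : f.RunsIn x y s) (hg : g.RunsIn y z t) :
    (Prog.seq f g).RunsIn x z (s + t + 1) :=
  let ⟨_, h₁, hf⟩ := hf
  let ⟨_, h₂, hg⟩ := hg
  ⟨_, by omega, .seq hf hg⟩

theorem cond_cons (hc : c.RunsIn x (.cons u v) s) (hf : f.RunsIn x z t) :
    (Prog.cond c f g).RunsIn x z (s + t + 1) :=
  let ⟨_, h₁, hc⟩ := hc
  let ⟨_, h₂, hf⟩ := hf
  ⟨_, by omega, .cond_cons hc hf⟩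

theorem cond_nil (hc : c.RunsIn x .nil s) (hg : g.RunsIn x z t) :
    (Prog.cond c f g).RunsIn x z (s + t + 1) :=
  let ⟨_, h₁, hc⟩ := hc
  let ⟨_, h₂, hg⟩ := hg
  ⟨_, by omega, .cond_nil hc hg⟩

theorem loop_cons (hc : c.RunsIn x (.cons u v) s) (hf : f.RunsIn x y t)
    (hl : (Prog.loop c f).RunsIn y z r) : (Prog.loop c f).RunsIn x z (s + t + r + 1) :=
  let ⟨_, h₁, hc⟩ := hc
  let ⟨_, h₂, hf⟩ := hf
  let ⟨_, h₃, hl⟩ := hl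
  ⟨_, by omega, .loop_cons hc hf hl⟩

theorem loop_nil (hc : c.RunsIn x .nil s) : (Prog.loop c f).RunsIn x x (s + 1) :=
  let ⟨_, h₁, hc⟩ := hc
  ⟨_, by omega, .loop_nil hc⟩

end Prog.RunsIn

/-! ### Typed encodings -/

/-- Types whose elements are represented by trees. -/
class TreeCode (α : Type*) where
  /-- the tree that represents an element -/
  enc : α → Data

open SpreadSAT.TreeCode (enc)

section PolynomialTime

instance : TreeCode Unit := ⟨fun _ => .nil⟩
instance : TreeCode Bool := ⟨encodeBool⟩
instance : TreeCode ℕ := ⟨encodeNat⟩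

variable {α β γ σ τ : Type*} [TreeCode α] [TreeCode β] [TreeCode γ] [TreeCode σ] [TreeCode τ]

instance : TreeCode (α × β) := ⟨fun p => .cons (enc p.1) (enc p.2)⟩
instance : TreeCode (List α) := ⟨fun l => encodeList (l.map enc)⟩
instance : TreeCode (Option α) := ⟨fun o => o.elim .nil fun a => .cons .nil (enc a)⟩

@[simp] theorem enc_unit (u : Unit) : enc u = .nil := rfl
@[simp] theorem enc_succ (n : ℕ) : enc (n + 1) = .cons .nil (enc n) := rfl
@[simp] theorem enc_prod (p : α × β) : enc p = .cons (enc p.1) (enc p.2) := rfl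
@[simp] theorem enc_nil : enc ([] : List α) = .nil := rfl
@[simp] theorem enc_cons (a : α) (l : List α) : enc (a :: l) = .cons (enc a) (enc l) := rfl

/-- The size of the tree that represents `a`. -/
def esize (a : α) : ℕ := (enc a).size

@[simp] theorem esize_unit (u : Unit) : esize u = 1 := rfl
@[simp] theorem esize_prod (p : α × β) : esize p = esize p.1 + esize p.2 + 1 := rfl
@[simp] theorem esize_nil : esize ([] : List α) = 1 := rfl
@[simp] theorem esize_cons (a : α) (l : List α) : esize (a :: l) = esize a + esize l + 1 := rfl
@[simp] theorem esize_none : esize (none : Option α) = 1 := rfl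

@[simp] theorem esize_nat (n : ℕ) : esize n = 2 * n + 1 := by
  induction n with
  | zero => rfl
  | succ n ih =>
    have : esize (n + 1) = 1 + esize n + 1 := rfl
    omega

theorem esize_bool_le (b : Bool) : esize b ≤ 3 := by cases b <;> decide

theorem length_lt_esize (l : List α) : l.length < esize l := by
  induction l with
  | nil => simp
  | cons a l ih => simp only [List.length_cons, esize_cons]; omega

theorem esize_le_of_mem {a : α} {l : List α} (h : a ∈ l) : esize a ≤ esize l := by
  induction l with
  | nil => simp at h
  | cons b l ih =>
    rcases List.mem_cons.1 h with rfl | h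
    · simp only [esize_cons]; omega
    · have := ih h; simp only [esize_cons]; omega

theorem esize_list_le {l : List α} {B : ℕ} (h : ∀ a ∈ l, esize a ≤ B) :
    esize l ≤ l.length * (B + 1) + 1 := by
  induction l with
  | nil => simp
  | cons a l ih =>
    have h1 := h a (by simp)
    have h2 := ih fun b hb => h b (by simp [hb])
    simp only [esize_cons, List.length_cons]
    nlinarith

theorem esize_sublist {l l' : List α} (h : l.Sublist l') : esize l ≤ esize l' := by
  induction h with
  | slnil => simp
  | cons a _ ih => simp only [esize_cons]; omega
  | cons_cons a _ ih => simp only [esize_cons]; omega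

theorem esize_append (l l' : List α) : esize (l ++ l') + 1 = esize l + esize l' := by
  induction l with
  | nil => simp; omega
  | cons a l ih => simp only [List.cons_append, esize_cons]; omega

theorem enc_replicate_unit (n : ℕ) : enc (List.replicate n ()) = enc n := by
  induction n with
  | zero => rfl
  | succ n ih => rw [List.replicate_succ, enc_cons, ih, enc_succ, enc_unit]

/-! ### Loops over lists -/

/-- Loop over a list: on the state `(l, (g, s))`, replace `s` by the results of running `P` on
`(g, (b, s))`, for the members `b` of `l` in turn. -/
def Prog.overList (P : Prog) : Prog :=
  .loop .head (.pair (.seq .head .tail) (.pair (.seq .tail .head)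
    (.seq (.pair (.seq .tail .head) (.pair (.seq .head .head) (.seq .tail .tail))) P)))

/-- The time bound is required only at states that occur, namely after a prefix `l₁` of the list.
Callers can thus use invariants of those states, such as size bounds. -/
theorem Prog.overList_runsIn {P : Prog} {step : σ → β → σ} {g : γ} {T : ℕ} (l : List β) (s : σ)
    (h : ∀ l₁ b l₂, l = l₁ ++ b :: l₂ →
      P.RunsIn (enc (g, b, l₁.foldl step s)) (enc (step (l₁.foldl step s) b)) T) :
    P.overList.RunsIn (enc (l, g, s)) (enc (([] : List β), g, l.foldl step s))
      (l.length * (T + 22) + 2) := by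
  induction l generalizing s with
  | nil =>
    refine (Prog.RunsIn.loop_nil (Prog.RunsIn.head)).mono (by simp)
  | cons b l ih =>
    have h0 := h [] b l rfl
    have h1 := ih (step s b) fun l₁ b' l₂ hl => h (b :: l₁) b' l₂ (by rw [hl]; rfl)
    refine (Prog.RunsIn.loop_cons (y := enc (l, g, step s b)) Prog.RunsIn.head
      (.pair (.seq .head .tail) (.pair (.seq .tail .head)
      (.seq (.pair (.seq .tail .head) (.pair (.seq .head .head) (.seq .tail .tail))) h0)))
      h1).mono ?_
    simp only [List.length_cons]
    nlinarith

/-! ### Functions computable in polynomial time -/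

theorem eval_mono (q : Polynomial ℕ) {x y : ℕ} (h : x ≤ y) : q.eval x ≤ q.eval y := by
  rw [Polynomial.eval_eq_sum_range, Polynomial.eval_eq_sum_range]
  gcongr

/-- `f` is computed by a program such that the running time and the size of the output are
polynomial in the size of the input. -/
def PolyTime (f : α → β) : Prop :=
  ∃ (P : Prog) (q : Polynomial ℕ), ∀ a, esize (f a) ≤ q.eval (esize a) ∧
    P.RunsIn (enc a) (enc (f a)) (q.eval (esize a))

/-- A polynomial bound for a quantity in terms of the size of the input. -/
def PolyBound (F : α → ℕ) : Prop := ∃ q : Polynomial ℕ, ∀ a, F a ≤ q.eval (esize a)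

namespace PolyBound

theorem size : PolyBound (fun a : α => esize a) := ⟨.X, by simp⟩

theorem const (c : ℕ) : PolyBound (fun _ : α => c) := ⟨.C c, by simp⟩

theorem add {F G : α → ℕ} (hF : PolyBound F) (hG : PolyBound G) :
    PolyBound (fun a => F a + G a) :=
  let ⟨p, hp⟩ := hF
  let ⟨q, hq⟩ := hG
  ⟨p + q, fun a => by rw [Polynomial.eval_add]; exact add_le_add (hp a) (hq a)⟩

theorem mul {F G : α → ℕ} (hF : PolyBound F) (hG : PolyBound G) :
    PolyBound (fun a => F a * G a) :=
  let ⟨p, hp⟩ := hF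
  let ⟨q, hq⟩ := hG
  ⟨p * q, fun a => by rw [Polynomial.eval_mul]; exact Nat.mul_le_mul (hp a) (hq a)⟩

theorem eval {F : α → ℕ} (hF : PolyBound F) (q : Polynomial ℕ) :
    PolyBound (fun a => q.eval (F a)) :=
  let ⟨p, hp⟩ := hF
  ⟨q.comp p, fun a => by rw [Polynomial.eval_comp]; exact eval_mono q (hp a)⟩

end PolyBound

/-- The running time and the output size may be bounded separately, by any quantities that have
polynomial bounds. -/
theorem PolyTime.of_bound {f : α → β} {P : Prog} {F G : α → ℕ} (hF : PolyBound F)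
    (hG : PolyBound G) (hs : ∀ a, esize (f a) ≤ F a)
    (hr : ∀ a, P.RunsIn (enc a) (enc (f a)) (G a)) : PolyTime f := by
  obtain ⟨p, hp⟩ := hF
  obtain ⟨q, hq⟩ := hG
  refine ⟨P, p + q, fun a => ⟨?_, (hr a).mono ?_⟩⟩
  · rw [Polynomial.eval_add]; exact (hs a).trans ((hp a).trans (Nat.le_add_right _ _))
  · rw [Polynomial.eval_add]; exact (hq a).trans (Nat.le_add_left _ _)

namespace PolyTime

theorem polyBound {f : α → β} (hf : PolyTime f) : PolyBound (fun a => esize (f a)) :=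
  let ⟨_, q, h⟩ := hf
  ⟨q, fun a => (h a).1⟩

/-- A function with the same encoded values. -/
theorem congr_enc {f : α → β} {f' : α → γ} (hf : PolyTime f) (h : ∀ a, enc (f' a) = enc (f a)) :
    PolyTime f' := by
  obtain ⟨P, q, hP⟩ := hf
  refine ⟨P, q, fun a => ⟨?_, ?_⟩⟩
  · rw [esize, h a]; exact (hP a).1
  · rw [h a]; exact (hP a).2

theorem of_enc_eq {f : α → β} (h : ∀ a, enc (f a) = enc a) : PolyTime f :=
  of_bound (P := .skip) PolyBound.size (.const 1) (fun a => by rw [esize, h a]; rfl)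
    fun a => by rw [h a]; exact .skip

protected theorem id : PolyTime (fun a : α => a) := of_enc_eq fun _ => rfl

theorem comp {f : α → β} {g : β → γ} (hg : PolyTime g) (hf : PolyTime f) :
    PolyTime (fun a => g (f a)) := by
  obtain ⟨P, p, hP⟩ := hf
  obtain ⟨Q, q, hQ⟩ := hg
  have hb : PolyBound fun a => esize (f a) := ⟨p, fun a => (hP a).1⟩
  exact of_bound (P := P.seq Q) (hb.eval q)
    (((PolyBound.size.eval p).add (hb.eval q)).add (.const 1))
    (fun a => (hQ _).1) fun a => (hP a).2.seq (hQ (f a)).2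

theorem pair {f : α → β} {g : α → γ} (hf : PolyTime f) (hg : PolyTime g) :
    PolyTime (fun a => (f a, g a)) := by
  have hf' := hf.polyBound
  have hg' := hg.polyBound
  obtain ⟨P, p, hP⟩ := hf
  obtain ⟨Q, q, hQ⟩ := hg
  exact of_bound (P := P.pair Q) ((hf'.add hg').add (.const 1))
    (((PolyBound.size.eval p).add (PolyBound.size.eval q)).add (.const 1))
    (fun a => le_rfl) fun a => (hP a).2.pair (hQ a).2

theorem fst {f : α → β × γ} (hf : PolyTime f) : PolyTime (fun a => (f a).1) :=
  comp (g := Prod.fst) (of_bound (P := .head) .size (.const 1)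
    (fun a => by rw [esize_prod]; omega) fun a => Prog.RunsIn.head) hf

theorem snd {f : α → β × γ} (hf : PolyTime f) : PolyTime (fun a => (f a).2) :=
  comp (g := Prod.snd) (of_bound (P := .tail) .size (.const 1)
    (fun a => by rw [esize_prod]; omega) fun a => Prog.RunsIn.tail) hf

theorem exists_const (d : Data) : ∃ (P : Prog) (t : ℕ), ∀ x, P.RunsIn x d t := by
  induction d with
  | nil => exact ⟨.nil, 1, fun x => .nil⟩
  | cons d e hd he =>
    obtain ⟨P, s, hP⟩ := hd
    obtain ⟨Q, t, hQ⟩ := he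
    exact ⟨P.pair Q, s + t + 1, fun x => (hP x).pair (hQ x)⟩

theorem const (b : β) : PolyTime (fun _ : α => b) := by
  obtain ⟨P, t, hP⟩ := exists_const (enc b)
  exact of_bound (P := P) (.const (esize b)) (.const t) (fun a => le_rfl) fun a => hP _

theorem ite {c : α → Bool} {f g : α → β} (hc : PolyTime c) (hf : PolyTime f) (hg : PolyTime g) :
    PolyTime (fun a => if c a then f a else g a) := by
  have hf' := hf.polyBound
  have hg' := hg.polyBound
  obtain ⟨R, r, hR⟩ := hc
  obtain ⟨P, p, hP⟩ := hf
  obtain ⟨Q, q, hQ⟩ := hg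
  refine of_bound (P := R.cond P Q) (hf'.add hg')
    (((PolyBound.size.eval r).add ((PolyBound.size.eval p).add (PolyBound.size.eval q))).add
      (.const 1)) (fun a => ?_) fun a => ?_
  · split_ifs <;> omega
  · have hr := (hR a).2
    rcases hca : c a with _ | _
    · rw [hca] at hr
      rw [if_neg (by simp)]
      exact (Prog.RunsIn.cond_nil hr (hQ a).2).mono (by omega)
    · rw [hca] at hr
      rw [if_pos rfl]
      exact (Prog.RunsIn.cond_cons hr (hP a).2).mono (by omega)

/-- A polynomial time step may square the size of the state, so iterating it can leave polynomial
time. The a priori bound `B` on the states after all prefixes excludes this. -/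
theorem foldl {l : α → List β} {s : α → σ} {step : α → σ → β → σ} (hl : PolyTime l)
    (hs : PolyTime s) (hstep : PolyTime (fun p : α × β × σ => step p.1 p.2.2 p.2.1))
    {B : α → ℕ} (hB : PolyBound B)
    (hsize : ∀ a, ∀ l' : List β, l' <+: l a → esize (l'.foldl (step a) (s a)) ≤ B a) :
    PolyTime (fun a => (l a).foldl (step a) (s a)) := by
  have hlb := hl.polyBound
  obtain ⟨L, p, hL⟩ := hl
  obtain ⟨S, q, hS⟩ := hs
  obtain ⟨P, r, hP⟩ := hstep
  refine of_bound (P := .seq (.pair L (.pair .skip S)) (.seq P.overList (.seq .tail .tail)))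
    (F := B) hB
    (G := fun a => (p.eval (esize a) + (1 + q.eval (esize a) + 1) + 1) +
      (((esize (l a)) * (r.eval (esize a + (esize (l a) + B a + 1) + 1) + 22) + 2) + 3 + 1) + 1)
    ?_ (fun a => hsize a _ (List.prefix_refl _)) fun a => ?_
  · refine (((PolyBound.size.eval p).add ((PolyBound.const 1).add (PolyBound.size.eval q)
      |>.add (.const 1))).add (.const 1)).add (PolyBound.add (PolyBound.add (PolyBound.add
        (hlb.mul (PolyBound.add (PolyBound.eval ?_ r) (.const 22))) (.const 2)) (.const 3))
          (.const 1)) |>.add (.const 1)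
    exact (PolyBound.size.add ((hlb.add hB).add (.const 1))).add (.const 1)
  · refine Prog.RunsIn.seq (y := enc (l a, a, s a)) (.pair (hL a).2 (.pair .skip (hS a).2))
      (Prog.RunsIn.seq (s := (esize (l a)) * _ + 2) (t := 3)
      ((Prog.overList_runsIn (T := r.eval (esize a + (esize (l a) + B a + 1) + 1))
        (step := step a) (g := a) (l a) (s a) ?_).mono ?_)
      ((Prog.RunsIn.tail).seq .tail))
    · intro l₁ b l₂ hl
      refine (hP (a, b, l₁.foldl (step a) (s a))).2.mono (eval_mono r ?_)
      simp only [esize_prod]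
      have h1 : esize b ≤ esize (l a) := esize_le_of_mem (by simp [hl])
      have h2 := hsize a l₁ ⟨b :: l₂, hl.symm⟩
      omega
    · have := (length_lt_esize (l a)).le
      gcongr

/-- A fold in which every step increases the size by an amount that is bounded in terms of the
input. -/
theorem foldl_of_add {l : α → List β} {s : α → σ} {step : α → σ → β → σ} (hl : PolyTime l)
    (hs : PolyTime s) (hstep : PolyTime (fun p : α × β × σ => step p.1 p.2.2 p.2.1))
    {B : α → ℕ} (hB : PolyBound B)
    (hsize : ∀ a s, ∀ b ∈ l a, esize (step a s b) ≤ esize s + B a) :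
    PolyTime (fun a => (l a).foldl (step a) (s a)) := by
  refine foldl hl hs hstep (B := fun a => esize (s a) + esize (l a) * B a)
    (hs.polyBound.add (hl.polyBound.mul hB)) fun a l' hl' => ?_
  have key : ∀ (m : List β) (t : σ), (∀ b ∈ m, b ∈ l a) →
      esize (m.foldl (step a) t) ≤ esize t + m.length * B a := by
    intro m
    induction m with
    | nil => simp
    | cons b m ih =>
      intro t hm
      have h1 := ih (step a t b) fun c hc => hm c (by simp [hc])
      have h2 := hsize a t b (hm b (by simp))
      simp only [List.foldl_cons, List.length_cons]
      nlinarith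
  refine (key l' (s a) fun b hb => hl'.subset hb).trans ?_
  have h1 := hl'.length_le
  have h2 := length_lt_esize (l a)
  gcongr
  omega

end PolyTime

/-! ### A library of polynomial time functions -/

namespace PolyTime

theorem cons {f : α → β} {g : α → List β} (hf : PolyTime f) (hg : PolyTime g) :
    PolyTime (fun a => f a :: g a) :=
  (hf.pair hg).congr_enc fun _ => rfl

theorem some {f : α → β} (hf : PolyTime f) : PolyTime (fun a => Option.some (f a)) :=
  ((const ()).pair hf).congr_enc fun _ => rfl

theorem isSome {f : α → Option β} (hf : PolyTime f) : PolyTime (fun a => (f a).isSome) := by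
  refine comp (g := Option.isSome) (of_bound (P := .cond .skip (.pair .nil .nil) .nil)
    (.const 3) (.const 5) (fun a => esize_bool_le _) fun a => ?_) hf
  cases a with
  | none => exact (Prog.RunsIn.cond_nil .skip .nil).mono (by norm_num)
  | some a => exact (Prog.RunsIn.cond_cons .skip (.pair .nil .nil))

theorem not {c : α → Bool} (hc : PolyTime c) : PolyTime (fun a => !c a) :=
  (hc.ite (const false) (const true)).congr_enc fun a => by cases c a <;> rfl

theorem and {c d : α → Bool} (hc : PolyTime c) (hd : PolyTime d) :
    PolyTime (fun a => c a && d a) :=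
  (hc.ite hd (const false)).congr_enc fun a => by cases c a <;> rfl

theorem or {c d : α → Bool} (hc : PolyTime c) (hd : PolyTime d) :
    PolyTime (fun a => c a || d a) :=
  (hc.ite (const true) hd).congr_enc fun a => by cases c a <;> rfl

theorem bne {c d : α → Bool} (hc : PolyTime c) (hd : PolyTime d) :
    PolyTime (fun a => c a != d a) :=
  (hc.ite hd.not hd).congr_enc fun a => by cases c a <;> cases d a <;> rfl

/-! #### Lists -/

theorem reverse {l : α → List β} (hl : PolyTime l) : PolyTime (fun a => (l a).reverse) := by
  have h := foldl_of_add (s := fun _ => ([] : List β)) (step := fun _ s b => b :: s)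
    (B := fun a => esize (l a) + 1) hl (const _)
    (cons (PolyTime.id.snd.fst) (PolyTime.id.snd.snd)) (hl.polyBound.add (.const 1))
    fun a s b hb => by have := esize_le_of_mem hb; simp only [esize_cons]; omega
  refine h.congr_enc fun a => ?_
  simp

theorem append {l l' : α → List β} (hl : PolyTime l) (hl' : PolyTime l') :
    PolyTime (fun a => l a ++ l' a) := by
  have h := foldl_of_add (s := l') (step := fun _ s b => b :: s)
    (B := fun a => esize (l a) + 1) hl.reverse hl'
    (cons (PolyTime.id.snd.fst) (PolyTime.id.snd.snd)) (hl.polyBound.add (.const 1))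
    fun a s b hb => by
      have := esize_le_of_mem (List.mem_reverse.1 hb); simp only [esize_cons]; omega
  refine h.congr_enc fun a => ?_
  simp

/-- A fold that conses its results reverses their order, so it runs over the reversed list. The same
is done in `append` and `filter`. -/
theorem map {l : α → List β} {f : α → β → γ} (hl : PolyTime l)
    (hf : PolyTime (fun p : α × β => f p.1 p.2)) : PolyTime (fun a => (l a).map (f a)) := by
  obtain ⟨q, hq⟩ := hf.polyBound
  have h := foldl_of_add (s := fun _ => ([] : List γ)) (step := fun a s b => f a b :: s)
    (B := fun a => q.eval (esize a + esize (l a) + 1) + 1) hl.reverse (const _)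
    (cons (hf.comp (PolyTime.id.fst.pair PolyTime.id.snd.fst)) (PolyTime.id.snd.snd))
    ((((PolyBound.size.add hl.polyBound).add (.const 1)).eval q).add (.const 1))
    fun a s b hb => by
      have h1 := esize_le_of_mem (List.mem_reverse.1 hb)
      have h2 := (hq (a, b)).trans (eval_mono q (y := esize a + esize (l a) + 1)
        (by simp only [esize_prod]; omega))
      simp only [esize_cons]
      simp only at h2
      omega
  refine h.congr_enc fun a => ?_
  congr 1
  induction l a with
  | nil => rfl
  | cons b l ih => rw [List.reverse_cons, List.foldl_append, ← ih]; rfl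

theorem filter {l : α → List β} {c : α → β → Bool} (hl : PolyTime l)
    (hc : PolyTime (fun p : α × β => c p.1 p.2)) : PolyTime (fun a => (l a).filter (c a)) := by
  have h := foldl_of_add (s := fun _ => ([] : List β))
    (step := fun a s b => if c a b then b :: s else s)
    (B := fun a => esize (l a) + 1) hl.reverse (const _)
    (ite (hc.comp (PolyTime.id.fst.pair PolyTime.id.snd.fst))
      (cons PolyTime.id.snd.fst PolyTime.id.snd.snd) PolyTime.id.snd.snd)
    (hl.polyBound.add (.const 1))
    fun a s b hb => by
      have h1 := esize_le_of_mem (List.mem_reverse.1 hb)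
      split_ifs
      · simp only [esize_cons]; omega
      · omega
  refine h.congr_enc fun a => ?_
  congr 1
  induction l a with
  | nil => rfl
  | cons b l ih => simp [List.foldl_append, ih, List.filter_cons]

theorem any {l : α → List β} {c : α → β → Bool} (hl : PolyTime l)
    (hc : PolyTime (fun p : α × β => c p.1 p.2)) : PolyTime (fun a => (l a).any (c a)) := by
  have h := foldl (s := fun _ => false) (step := fun a s b => s || c a b)
    (B := fun _ => 3) hl (const _)
    (or PolyTime.id.snd.snd (hc.comp (PolyTime.id.fst.pair PolyTime.id.snd.fst)))
    (.const 3) fun _ _ _ => esize_bool_le _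
  refine h.congr_enc fun a => ?_
  have : ∀ (m : List β) (s : Bool), m.foldl (fun s b => s || c a b) s = (s || m.any (c a)) := by
    intro m
    induction m with
    | nil => simp
    | cons b m ih => intro s; simp [ih, Bool.or_assoc]
  simp [this]

theorem all {l : α → List β} {c : α → β → Bool} (hl : PolyTime l)
    (hc : PolyTime (fun p : α × β => c p.1 p.2)) : PolyTime (fun a => (l a).all (c a)) :=
  (hl.any hc.not).not.congr_enc fun a => by rw [List.all_eq_not_any_not]

/-! #### Natural numbers -/

theorem replicate {f : α → ℕ} (hf : PolyTime f) :
    PolyTime (fun a => List.replicate (f a) ()) :=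
  hf.congr_enc fun _ => enc_replicate_unit _

theorem succ {f : α → ℕ} (hf : PolyTime f) : PolyTime (fun a => f a + 1) :=
  ((const ()).pair hf).congr_enc fun _ => rfl

theorem length {l : α → List β} (hl : PolyTime l) : PolyTime (fun a => (l a).length) :=
  (hl.map (f := fun _ _ => ()) (const ())).congr_enc fun a => by
    rw [List.map_const', enc_replicate_unit]

theorem countP {l : α → List β} {c : α → β → Bool} (hl : PolyTime l)
    (hc : PolyTime (fun p : α × β => c p.1 p.2)) : PolyTime (fun a => (l a).countP (c a)) :=
  (hl.filter hc).length.congr_enc fun a => by rw [List.countP_eq_length_filter]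

theorem pred {f : α → ℕ} (hf : PolyTime f) : PolyTime (fun a => f a - 1) :=
  comp (g := fun n => n - 1) (of_bound (P := .tail) .size (.const 1)
    (fun a => by rw [esize_nat, esize_nat]; omega) fun a => by
      cases a with
      | zero => exact Prog.RunsIn.tail
      | succ a => exact Prog.RunsIn.tail) hf

theorem pos {f : α → ℕ} (hf : PolyTime f) : PolyTime (fun a => decide (0 < f a)) := by
  refine comp (g := fun n => decide (0 < n)) (of_bound
    (P := .cond .skip (.pair .nil .nil) .nil)
    (.const 3) (.const 5) (fun a => esize_bool_le _) fun a => ?_) hf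
  cases a with
  | zero => exact (Prog.RunsIn.cond_nil .skip .nil).mono (by norm_num)
  | succ a =>
    rw [decide_eq_true (Nat.succ_pos a)]
    exact (Prog.RunsIn.cond_cons .skip (.pair .nil .nil))

/-- Repeat a polynomial time step that increases the size by a bounded amount. -/
theorem iterate_of_add {f : α → ℕ} {s : α → σ} {step : α → σ → σ} (hf : PolyTime f)
    (hs : PolyTime s) (hstep : PolyTime (fun p : α × σ => step p.1 p.2)) {B : α → ℕ}
    (hB : PolyBound B) (hsize : ∀ a s, esize (step a s) ≤ esize s + B a) :
    PolyTime (fun a => (step a)^[f a] (s a)) := by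
  have h := foldl_of_add (step := fun a s (_ : Unit) => step a s) hf.replicate hs
    (hstep.comp (PolyTime.id.fst.pair PolyTime.id.snd.snd)) hB fun a s b _ => hsize a s
  have key : ∀ a n (s : σ), (step a)^[n] s =
      (List.replicate n ()).foldl (fun s _ => step a s) s := by
    intro a n
    induction n with
    | zero => exact fun _ => rfl
    | succ n ih => exact fun s => ih (step a s)
  exact h.congr_enc fun a => by rw [key]

theorem sub {f g : α → ℕ} (hf : PolyTime f) (hg : PolyTime g) :
    PolyTime (fun a => f a - g a) := by
  refine (iterate_of_add (step := fun _ s => s - 1) (B := fun _ => 0) hg hf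
    (pred PolyTime.id.snd) (.const 0) fun a s => by simp only [esize_nat]; omega).congr_enc
      fun a => ?_
  have : ∀ n s : ℕ, (fun s => s - 1)^[n] s = s - n := by
    intro n
    induction n with
    | zero => simp
    | succ n ih => intro s; rw [Function.iterate_succ_apply, ih]; omega
  rw [this]

theorem add {f g : α → ℕ} (hf : PolyTime f) (hg : PolyTime g) :
    PolyTime (fun a => f a + g a) := by
  refine (iterate_of_add (step := fun _ s => s + 1) (B := fun _ => 2) hg hf
    (succ PolyTime.id.snd) (.const 2) fun a s => by simp only [esize_nat]; omega).congr_enc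
      fun a => ?_
  rw [Nat.succ_iterate]

theorem mul {f g : α → ℕ} (hf : PolyTime f) (hg : PolyTime g) :
    PolyTime (fun a => f a * g a) := by
  refine (iterate_of_add (s := fun _ => 0) (step := fun a s => s + g a)
    (B := fun a => esize (g a)) hf (const 0)
    (add PolyTime.id.snd (hg.comp PolyTime.id.fst)) hg.polyBound
    fun a s => by simp only [esize_nat]; omega).congr_enc fun a => ?_
  have : ∀ n s : ℕ, (fun s => s + g a)^[n] s = s + n * g a := by
    intro n
    induction n with
    | zero => simp
    | succ n ih => intro s; rw [Function.iterate_succ_apply, ih]; ring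
  rw [this, zero_add]

theorem decide_le {f g : α → ℕ} (hf : PolyTime f) (hg : PolyTime g) :
    PolyTime (fun a => decide (f a ≤ g a)) :=
  -- Truncated subtraction: `f a ≤ g a` if and only if `f a - g a` is not positive.
  (hf.sub hg).pos.not.congr_enc fun a => by
    congr 1
    rw [eq_comm, ← decide_not]
    exact decide_eq_decide.2 (by omega)

theorem decide_eq {f g : α → ℕ} (hf : PolyTime f) (hg : PolyTime g) :
    PolyTime (fun a => decide (f a = g a)) :=
  ((hf.decide_le hg).and (hg.decide_le hf)).congr_enc fun a => by
    congr 1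
    rw [← Bool.decide_and]
    exact decide_eq_decide.2 (by omega)

theorem range {f : α → ℕ} (hf : PolyTime f) : PolyTime (fun a => List.range (f a)) := by
  -- The state carries a counter next to the list of its previous values.
  have key : ∀ l : List Unit, l.foldl (fun (s : ℕ × List ℕ) _ => (s.1 + 1, s.1 :: s.2)) (0, [])
      = (l.length, (List.range l.length).reverse) := by
    intro l
    induction l using List.reverseRecOn with
    | nil => rfl
    | append_singleton l a ih => simp [List.foldl_append, ih, List.range_succ]
  have h := foldl (s := fun _ => ((0, []) : ℕ × List ℕ))
    (step := fun _ s _ => (s.1 + 1, s.1 :: s.2)) hf.replicate (const _)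
    (pair (succ PolyTime.id.snd.snd.fst)
      (cons PolyTime.id.snd.snd.fst PolyTime.id.snd.snd.snd))
    (B := fun a => esize (f a) + (esize (f a) * (esize (f a) + 1) + 1) + 1)
    ((hf.polyBound.add (((hf.polyBound.mul (hf.polyBound.add (.const 1)))).add (.const 1))).add
      (.const 1)) fun a l' hl' => by
      have hlen : l'.length ≤ f a := by simpa using hl'.length_le
      rw [key, esize_prod]
      have h1 : esize (List.range l'.length).reverse ≤
          l'.length * (esize (f a) + 1) + 1 := by
        refine (esize_list_le (B := esize (f a)) fun i hi => ?_).trans (by simp)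
        have := List.mem_range.1 (List.mem_reverse.1 hi)
        simp only [esize_nat]; omega
      have h2 : l'.length * (esize (f a) + 1) ≤ esize (f a) * (esize (f a) + 1) :=
        Nat.mul_le_mul_right _ (by simp only [esize_nat]; omega)
      have h3 : esize l'.length ≤ esize (f a) := by simp only [esize_nat]; omega
      simp only
      omega
  refine h.snd.reverse.congr_enc fun a => ?_
  rw [key]
  simp

end PolyTime

end PolynomialTime

/-! ### The container procedure

The procedure works on a list `F` of clauses with vertex set `W`. It repeatedly asks an oracle
whether a vertex `v` belongs to an (unknown) independent set `I`. If it does, `v` is removed from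
some of the current clauses; if it does not, then `v` is recorded and its clauses are
discarded, that is, replaced by the empty clause. -/

section Procedure

variable {V : Type*} [DecidableEq V]

/-- The number of current clauses of size `j` that contain `u`. -/
def deg (L : List (List V)) (j : ℕ) (u : V) : ℕ :=
  L.countP fun e => decide (e.length = j) && decide (u ∈ e)

/-- The constants of the procedure: the clause size `k`, and the parameters `K` and `R` of its
thresholds. -/
structure Params where
  /-- the clause size -/
  k : ℕ
  /-- the ratio between the thresholds of successive levels -/
  K : ℕ
  /-- the ratio between the thresholds for saturation and for queries -/
  R : ℕ

variable (p : Params) (m n : ℕ)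

/-- The vertex `u` is saturated at level `j`. -/
def saturated (L : List (List V)) (j : ℕ) (u : V) : Bool :=
  decide (m ≤ deg L j u * p.K ^ (p.k - j) * n)

/-- The clause `e` of size `j` may be shortened by removing `v`. -/
def eligible (L : List (List V)) (j : ℕ) (v : V) (e : List V) : Bool :=
  decide (e.length = j) &&
    (decide (v ∈ e) && e.all fun u => decide (u = v) || !saturated p m n L (j - 1) u)

/-- The vertex `v` is to be queried at level `j`. -/
def heavy (L : List (List V)) (j : ℕ) (v : V) : Bool :=
  decide (m ≤ L.countP (eligible p m n L j v) * (p.R * p.K ^ (p.k - j)) * n)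

/-- Remove `v` from the clauses that satisfy `c`. -/
def removeFrom (c : List V → Bool) (v : V) (L : List (List V)) : List (List V) :=
  L.map fun e => if c e then e.filter fun u => !decide (u = v) else e

/-- Discard the clauses that contain `v`. -/
def discard (v : V) (L : List (List V)) : List (List V) :=
  L.map fun e => if decide (v ∈ e) then [] else e

/-- The state of the procedure: the recorded vertices and the current clauses. -/
abbrev State (V : Type*) := List V × List (List V)

/-- Query `v` at level `j`, if it is heavy, and update the state. -/
def act (O : V → Bool) (s : State V) (j : ℕ) (v : V) : State V :=
  if heavy p m n s.2 j v then
    if O v then (s.1, removeFrom (eligible p m n s.2 j v) v s.2)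
    else (v :: s.1, discard v s.2)
  else s

/-- Treat all vertices in the list `W` at all levels. -/
def pass (O : V → Bool) (W : List V) (s : State V) : State V :=
  W.foldl (fun s v => (List.range p.k).foldl (fun s i => act p m n O s (i + 1) v) s) s

/-- The number of occurrences of vertices in the current clauses. -/
def volume (L : List (List V)) : ℕ := (L.map List.length).sum

/-- The potential of a family of clauses. -/
def potential (L : List (List V)) : ℕ :=
  (L.map fun e => if e = [] then 0 else p.K ^ (p.k - e.length)).sum

/-- The contribution to the potential of the clauses that contain `u`. -/
def weightAt (L : List (List V)) (u : V) : ℕ :=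
  (L.map fun e => if u ∈ e then p.K ^ (p.k - e.length) else 0).sum

/-! ### Double counting and changes of the potential -/

section Counting

theorem countP_le_add {β : Type*} {c d e : β → Bool} {L : List β}
    (h : ∀ a ∈ L, c a → d a ∨ e a) : L.countP c ≤ L.countP d + L.countP e := by
  induction L with
  | nil => simp
  | cons a L ih =>
    have h1 := ih fun b hb => h b (by simp [hb])
    have h2 := h a (by simp)
    simp only [List.countP_cons]
    rcases hc : c a with _ | _
    · simp; omega
    · rcases h2 hc with h3 | h3 <;> simp [h3] <;> omega

theorem countP_le_sum {β ι : Type*} {c : β → Bool} {d : ι → β → Bool} {A : Finset ι} {L : List β}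
    (h : ∀ a ∈ L, c a → ∃ i ∈ A, d i a) : L.countP c ≤ ∑ i ∈ A, L.countP (d i) := by
  induction L with
  | nil => simp
  | cons a L ih =>
    have h1 := ih fun b hb => h b (by simp [hb])
    simp only [List.countP_cons, Finset.sum_add_distrib]
    refine add_le_add h1 ?_
    split_ifs with hc
    · obtain ⟨i, hi, hd⟩ := h a (by simp) hc
      refine le_trans ?_ (Finset.single_le_sum (f := fun i => if d i a = true then 1 else 0)
        (fun _ _ => Nat.zero_le _) hi)
      simp [hd]
    · exact Nat.zero_le _

/-- Double counting of the incidences between vertices and clauses of size `j`. -/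
theorem sum_deg {L : List (List V)} {W : Finset V} (hn : ∀ e ∈ L, e.Nodup)
    (hW : ∀ e ∈ L, ∀ u ∈ e, u ∈ W) (j : ℕ) :
    ∑ u ∈ W, deg L j u = j * L.countP fun e => decide (e.length = j) := by
  induction L with
  | nil => simp [deg]
  | cons e L ih =>
    have h1 := ih (fun b hb => hn b (by simp [hb])) fun b hb => hW b (by simp [hb])
    simp only [deg] at h1
    simp only [deg, List.countP_cons, Finset.sum_add_distrib, h1, mul_add]
    congr 1
    by_cases hj : e.length = j
    · have h2 : ∑ u ∈ W, (if u ∈ e then 1 else 0) = e.length := by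
        rw [← Finset.card_filter, ← List.toFinset_card_of_nodup (hn e (by simp))]
        have : W.filter (· ∈ e) = e.toFinset := by
          ext u
          simpa using hW e (by simp) u
        simp [this]
      simpa [hj] using h2
    · simp [hj]

theorem weightAt_eq {L : List (List V)} (hk : ∀ e ∈ L, e.length ≤ p.k) (u : V) :
    weightAt p L u = ∑ j ∈ Finset.Icc 1 p.k, deg L j u * p.K ^ (p.k - j) := by
  induction L with
  | nil => simp [deg, weightAt]
  | cons e L ih =>
    have h1 := ih fun b hb => hk b (by simp [hb])
    simp only [deg, weightAt] at h1
    simp only [deg, weightAt, List.countP_cons, List.map_cons, List.sum_cons, add_mul,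
      Finset.sum_add_distrib, ← h1]
    rw [add_comm]
    congr 1
    by_cases hu : u ∈ e
    · have h2 : 1 ≤ e.length := List.length_pos_of_mem hu
      have h3 := hk e (by simp)
      simp [hu, h2, h3]
    · simp [hu]

/-- A nonempty clause is counted at each of its vertices, hence at least once. -/
theorem potential_le_sum {L : List (List V)} {W : Finset V} (hW : ∀ e ∈ L, ∀ u ∈ e, u ∈ W) :
    potential p L ≤ ∑ u ∈ W, weightAt p L u := by
  induction L with
  | nil => simp [potential, weightAt]
  | cons e L ih =>
    have h1 := ih fun b hb => hW b (by simp [hb])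
    simp only [potential, weightAt, List.map_cons, List.sum_cons, Finset.sum_add_distrib] at h1 ⊢
    refine add_le_add ?_ h1
    rcases e with _ | ⟨u, e⟩
    · simp
    · refine le_trans ?_ (Finset.single_le_sum (f := fun v => if v ∈ u :: e then
        p.K ^ (p.k - (u :: e).length) else 0) (fun _ _ => Nat.zero_le _) (hW (u :: e) (by simp) u (by simp)))
      simp

theorem potential_discard (L : List (List V)) (v : V) :
    potential p L ≤ potential p (discard v L) + weightAt p L v := by
  induction L with
  | nil => simp [potential]
  | cons e L ih =>
    simp only [potential, discard, weightAt, List.map_cons, List.sum_cons] at ih ⊢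
    by_cases hv : v ∈ e
    · have : e ≠ [] := List.ne_nil_of_mem hv
      simp only [hv, this, if_true, if_false, decide_true]
      omega
    · simp only [hv, decide_false, if_false, Bool.false_eq_true]
      omega

/-- Shortening a clause multiplies its weight by `K = q + 1`, a gain of `q` times the old weight.
The shortened clause must be nonempty, because empty clauses weigh nothing. -/
theorem potential_removeFrom {c : List V → Bool} {v : V} {L : List (List V)} {j q : ℕ}
    (hK : p.K = q + 1) (hjk : j + 1 ≤ p.k)
    (hc : ∀ e ∈ L, c e → e.length = j + 1 ∧ (e.filter fun u => !decide (u = v)).length = j ∧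
      e.filter (fun u => !decide (u = v)) ≠ []) :
    potential p L + L.countP c * (p.K ^ (p.k - (j + 1)) * q) ≤ potential p (removeFrom c v L) := by
  induction L with
  | nil => simp [potential]
  | cons e L ih =>
    have h1 := ih fun b hb => hc b (by simp [hb])
    simp only [potential, removeFrom, List.map_cons, List.sum_cons, List.countP_cons] at h1 ⊢
    by_cases he : c e = true
    · obtain ⟨h2, h3, h4⟩ := hc e (by simp) he
      have h5 : e ≠ [] := by rintro rfl; simp at h2
      have h6 : p.k - j = p.k - (j + 1) + 1 := by omega
      simp only [he, if_true, h4, h5, if_false, h2, h3, h6, pow_succ]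
      have : p.K ^ (p.k - (j + 1)) * p.K = p.K ^ (p.k - (j + 1)) * q + p.K ^ (p.k - (j + 1)) := by
        rw [hK]; ring
      rw [this, add_mul, one_mul]
      omega
    · simp only [he, if_false, Bool.false_eq_true, add_zero]
      omega

theorem volume_map_le {β : Type*} {f : List β → List β} {L : List (List β)}
    (h : ∀ e ∈ L, (f e).length ≤ e.length) : volume (L.map f) ≤ volume L := by
  induction L with
  | nil => simp
  | cons e L ih =>
    have h1 := ih fun b hb => h b (by simp [hb])
    have h2 := h e (by simp)
    simp only [volume, List.map_cons, List.sum_cons] at h1 ⊢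
    omega

theorem volume_map_lt {β : Type*} {f : List β → List β} {L : List (List β)}
    (h : ∀ e ∈ L, (f e).length ≤ e.length) {e : List β} (he : e ∈ L)
    (hlt : (f e).length < e.length) : volume (L.map f) < volume L := by
  induction L with
  | nil => simp at he
  | cons d L ih =>
    have h1 := volume_map_le fun b hb => h b (List.mem_cons_of_mem d hb)
    have h2 := h d (by simp)
    simp only [volume, List.map_cons, List.sum_cons] at h1 ih ⊢
    rcases List.mem_cons.1 he with rfl | he
    · omega
    · have := ih (fun b hb => h b (by simp [hb])) he
      omega

end Counting

/-! #### Termination -/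

section Termination

variable {p m n}

theorem eligible_iff {L : List (List V)} {j : ℕ} {v : V} {e : List V} :
    eligible p m n L j v e = true ↔ e.length = j ∧ v ∈ e ∧
      ∀ u ∈ e, u = v ∨ deg L (j - 1) u * p.K ^ (p.k - (j - 1)) * n < m := by
  simp [eligible, saturated]

theorem exists_eligible (hm : 0 < m) {L : List (List V)} {j : ℕ} {v : V}
    (h : heavy p m n L j v = true) : ∃ e ∈ L, eligible p m n L j v e := by
  by_contra! hc
  have h0 : L.countP (eligible p m n L j v) = 0 := List.countP_eq_zero.2 hc
  simp [heavy, h0] at h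
  omega

theorem volume_act (hm : 0 < m) (O : V → Bool) (s : State V) (j : ℕ) (v : V) :
    (heavy p m n s.2 j v = true → volume (act p m n O s j v).2 < volume s.2) := by
  intro h
  obtain ⟨e, he, hel⟩ := exists_eligible hm h
  have hve := (eligible_iff.1 hel).2.1
  rw [act, if_pos h]
  split_ifs
  · refine volume_map_lt (fun d _ => ?_) he ?_
    · split_ifs
      · exact List.length_filter_le _ _
      · exact le_rfl
    · rw [if_pos hel]
      exact List.length_filter_lt_length_iff_exists.2 ⟨v, hve, by simp⟩
  · refine volume_map_lt (fun d _ => ?_) he ?_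
    · split_ifs <;> simp
    · simp [hve, List.length_pos_of_mem hve]

theorem act_of_not_heavy {O : V → Bool} {s : State V} {j : ℕ} {v : V}
    (h : ¬ heavy p m n s.2 j v = true) : act p m n O s j v = s := by
  rw [act, if_neg h]

/-- The list of the pairs of a vertex and a level in the order in which a pass treats them. -/
def schedule (k : ℕ) (W : List V) : List (ℕ × V) :=
  W.flatMap fun v => (List.range k).map fun i => (i + 1, v)

theorem mem_schedule {β : Type*} {k : ℕ} {W : List β} {a : ℕ × β} :
    a ∈ schedule k W ↔ (1 ≤ a.1 ∧ a.1 ≤ k) ∧ a.2 ∈ W := by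
  obtain ⟨j, v⟩ := a
  simp only [schedule, List.mem_flatMap, List.mem_map, List.mem_range, Prod.mk.injEq]
  constructor
  · rintro ⟨v, hv, i, hi, rfl, rfl⟩
    exact ⟨⟨by omega, by omega⟩, hv⟩
  · rintro ⟨⟨h1, h2⟩, hv⟩
    exact ⟨v, hv, j - 1, by omega, by omega, rfl⟩

theorem pass_eq (O : V → Bool) (W : List V) (s : State V) :
    pass p m n O W s = (schedule p.k W).foldl (fun s a => act p m n O s a.1 a.2) s := by
  rw [schedule, List.foldl_flatMap]
  simp only [List.foldl_map]
  rfl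

/-- The volume is the termination measure: it drops at every query, and a sequence of actions
without a query leaves the state alone and thereby certifies that nothing on the list is heavy. -/
theorem volume_foldl_act (hm : 0 < m) (O : V → Bool) (l : List (ℕ × V)) (s : State V) :
    volume (l.foldl (fun s a => act p m n O s a.1 a.2) s).2 < volume s.2 ∨
      (l.foldl (fun s a => act p m n O s a.1 a.2) s = s ∧
        ∀ a ∈ l, ¬ heavy p m n s.2 a.1 a.2 = true) := by
  induction l generalizing s with
  | nil => simp
  | cons a l ih =>
    rw [List.foldl_cons]
    by_cases h : heavy p m n s.2 a.1 a.2 = true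
    · left
      have h1 := volume_act hm O s a.1 a.2 h
      rcases ih (act p m n O s a.1 a.2) with h2 | h2
      · omega
      · rw [h2.1]; exact h1
    · rw [act_of_not_heavy h]
      rcases ih s with h2 | h2
      · exact .inl h2
      · refine .inr ⟨h2.1, fun b hb => ?_⟩
        rcases List.mem_cons.1 hb with rfl | hb
        · exact h
        · exact h2.2 b hb

/-- The volume can drop at most `T` times, so one of the passes changes nothing, and the state is
fixed from then on. In the case `T = 0` the volume is already zero, and a further pass could not
lower it. -/
theorem not_heavy_of_iterate (hm : 0 < m) (O : V → Bool) (W : List V) (T : ℕ) (s : State V)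
    (hT : volume s.2 ≤ T) {j : ℕ} (hj : 1 ≤ j) (hjk : j ≤ p.k) {v : V} (hv : v ∈ W) :
    ¬ heavy p m n ((pass p m n O W)^[T] s).2 j v = true := by
  have hmem : ((j, v) : ℕ × V) ∈ schedule p.k W := mem_schedule.2 ⟨⟨hj, hjk⟩, hv⟩
  induction T generalizing s with
  | zero =>
    rcases volume_foldl_act hm O (schedule p.k W) s with h | h
    · omega
    · exact h.2 _ hmem
  | succ T ih =>
    rw [Function.iterate_succ_apply]
    rcases volume_foldl_act hm O (schedule p.k W) s with h | h
    · rw [← pass_eq (n := n)] at h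
      exact ih _ (by omega)
    · rw [← pass_eq (n := n)] at h
      rw [h.1, Function.iterate_fixed h.1]
      exact h.2 _ hmem

end Termination

end Procedure

/-! ### Degree bounds during the run, and the invariant of the procedure -/

section Containers

variable {V : Type*} [DecidableEq V] {p : Params} {m n Λ : ℕ} {W : Finset V} {I : V → Prop}
  {F L : List (List V)} {X : List V}

/-- The properties of the current clauses that bound the progress of the procedure. -/
structure Spread (p : Params) (m n Λ : ℕ) (W : Finset V) (L : List (List V)) : Prop where
  nodup : ∀ e ∈ L, e.Nodup
  subset : ∀ e ∈ L, ∀ u ∈ e, u ∈ W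
  length_le : ∀ e ∈ L, e.length ≤ p.k
  deg_le : ∀ j, 1 ≤ j → j ≤ p.k → ∀ u, deg L j u * p.K ^ (p.k - j) * n ≤ Λ * m
  codeg_le : ∀ u v, u ≠ v →
    (L.countP fun e => decide (u ∈ e) && decide (v ∈ e)) * p.K ^ p.k * n ≤ m

theorem deg_map_le {f : List V → List V} (hf : ∀ e, f e = e ∨ f e = []) {j : ℕ} (hj : 1 ≤ j)
    (L : List (List V)) (u : V) : deg (L.map f) j u ≤ deg L j u := by
  rw [deg, List.countP_map]
  refine List.countP_mono_left fun e _ he => ?_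
  rcases hf e with h | h
  · simpa [h] using he
  · simp only [Function.comp, h, List.length_nil, Bool.and_eq_true, decide_eq_true_eq] at he
    omega

theorem codeg_map_le {f : List V → List V} (hf : ∀ e, (f e).Sublist e) (L : List (List V))
    (u v : V) : (L.map f).countP (fun e => decide (u ∈ e) && decide (v ∈ e)) ≤
      L.countP fun e => decide (u ∈ e) && decide (v ∈ e) := by
  rw [List.countP_map]
  refine List.countP_mono_left fun e _ he => ?_
  simp only [Function.comp, Bool.and_eq_true, decide_eq_true_eq] at he ⊢
  exact ⟨(hf e).subset he.1, (hf e).subset he.2⟩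

/-- All conditions except the degree bounds are inherited when clauses shrink. A degree may grow,
since a shortened clause enters a lower level. -/
theorem Spread.map_of_sublist (h : Spread p m n Λ W L) {f : List V → List V}
    (hf : ∀ e, (f e).Sublist e)
    (hd : ∀ j, 1 ≤ j → j ≤ p.k → ∀ u, deg (L.map f) j u * p.K ^ (p.k - j) * n ≤ Λ * m) :
    Spread p m n Λ W (L.map f) where
  nodup := by
    intro e' he'
    obtain ⟨e, he, rfl⟩ := List.mem_map.1 he'
    exact (h.nodup e he).sublist (hf e)
  subset := by
    intro e' he' u hu
    obtain ⟨e, he, rfl⟩ := List.mem_map.1 he'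
    exact h.subset e he u ((hf e).subset hu)
  length_le := by
    intro e' he'
    obtain ⟨e, he, rfl⟩ := List.mem_map.1 he'
    exact (hf e).length_le.trans (h.length_le e he)
  deg_le := hd
  codeg_le u v huv := by
    refine le_trans ?_ (h.codeg_le u v huv)
    gcongr
    exact codeg_map_le hf L u v

theorem Spread.discard (h : Spread p m n Λ W L) (v : V) :
    Spread p m n Λ W (discard v L) := by
  refine h.map_of_sublist (fun e => ?_) fun j hj hjk u => ?_
  · split_ifs <;> simp
  · refine le_trans ?_ (h.deg_le j hj hjk u)
    gcongr
    refine deg_map_le (fun e => ?_) hj L u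
    split_ifs <;> simp

/-- The degree of `u` at level `j` can grow only if an eligible clause through `u` drops to that
level, and eligibility says that `u` was unsaturated there. The new clauses at `u` all contained
both `u` and `v`, so the codegree bounds their number. In normalised units the degree was below `m`
and grows by at most `m`, which gives `2 m ≤ Λ m`. -/
theorem Spread.removeFrom (h : Spread p m n Λ W L) (hK : 1 ≤ p.K) (hΛ : 2 ≤ Λ) (i : ℕ) (v : V) :
    Spread p m n Λ W (removeFrom (eligible p m n L i v) v L) := by
  refine h.map_of_sublist (fun e => ?_) fun j hj hjk u => ?_
  · split_ifs
    · exact List.filter_sublist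
    · exact List.Sublist.refl _
  · set f : List V → List V := fun e =>
      if eligible p m n L i v e then e.filter fun u => !decide (u = v) else e with hf
    by_cases hex : ∃ e ∈ L, eligible p m n L i v e = true ∧ i - 1 = j ∧ u ∈ e ∧ u ≠ v
    · obtain ⟨e, he, hel, hij, hue, huv⟩ := hex
      have hd : deg L j u * p.K ^ (p.k - j) * n < m := by
        have := ((eligible_iff.1 hel).2.2 u hue).resolve_left huv
        rwa [hij] at this
      have hc := h.codeg_le u v huv
      have hle : deg (L.map f) j u ≤ deg L j u +
          L.countP fun e => decide (u ∈ e) && decide (v ∈ e) := by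
        rw [deg, List.countP_map]
        refine countP_le_add fun e _ hd => ?_
        simp only [Function.comp, hf] at hd
        by_cases hel' : eligible p m n L i v e = true
        · right
          simp only [hel', if_true] at hd
          simp only [Bool.and_eq_true, decide_eq_true_eq, List.mem_filter] at hd ⊢
          exact ⟨hd.2.1, (eligible_iff.1 hel').2.1⟩
        · left
          simpa only [hel', if_false, Bool.false_eq_true] using hd
      have hpow : p.K ^ (p.k - j) ≤ p.K ^ p.k := Nat.pow_le_pow_right hK (Nat.sub_le _ _)
      calc deg (L.map f) j u * p.K ^ (p.k - j) * n
          ≤ (deg L j u + L.countP fun e => decide (u ∈ e) && decide (v ∈ e)) *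
              p.K ^ (p.k - j) * n := by gcongr
        _ = deg L j u * p.K ^ (p.k - j) * n +
            (L.countP fun e => decide (u ∈ e) && decide (v ∈ e)) * p.K ^ (p.k - j) * n := by ring
        _ ≤ m + (L.countP fun e => decide (u ∈ e) && decide (v ∈ e)) * p.K ^ p.k * n := by gcongr
        _ ≤ m + m := by gcongr
        _ = 2 * m := by ring
        _ ≤ Λ * m := by gcongr
    · push Not at hex
      refine le_trans ?_ (h.deg_le j hj hjk u)
      gcongr
      change deg (L.map f) j u ≤ deg L j u
      rw [deg, List.countP_map]
      refine List.countP_mono_left fun e he hd => ?_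
      simp only [Function.comp, hf] at hd
      by_cases hel : eligible p m n L i v e = true
      · exfalso
        have hel' := eligible_iff.1 hel
        simp only [hel, if_true] at hd
        simp only [Bool.and_eq_true, decide_eq_true_eq, List.mem_filter, Bool.not_eq_true',
          decide_eq_false_iff_not] at hd
        refine hd.2.2 (hex e he hel ?_ hd.2.1)
        have h1 : (e.filter fun u => !decide (u = v)) = e.erase v := by
          rw [(h.nodup e he).erase_eq_filter]
          refine List.filter_congr fun x _ => ?_
          by_cases hx : x = v <;> simp [hx]
        have h2 := hd.1
        rw [h1, List.length_erase_of_mem hel'.2.1, hel'.1] at h2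
        exact h2
      · simpa only [hel, if_false, Bool.false_eq_true] using hd

theorem Spread.weightAt_le (h : Spread p m n Λ W L) (u : V) :
    n * weightAt p L u ≤ p.k * (Λ * m) := by
  rw [weightAt_eq p h.length_le, Finset.mul_sum]
  refine (Finset.sum_le_card_nsmul _ _ (Λ * m) fun j hj => ?_).trans (by simp)
  have := h.deg_le j (Finset.mem_Icc.1 hj).1 (Finset.mem_Icc.1 hj).2 u
  rwa [mul_comm]

/-! #### The clauses that survive -/

/-- A clause of size `i + 1` without vertices saturated at level `i` is eligible at any of its
vertices, and no vertex is heavy, so there are few of these. The others contain a saturated vertex.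
There are few saturated vertices, by double counting at level `i`, and each has bounded degree at
level `i + 1`. -/
theorem Spread.count_step (h : Spread p m n Λ W L) (hn : 0 < n)
    (hW : W.card ≤ 2 * n)
    (hs : ∀ j, 1 ≤ j → j ≤ p.k → ∀ v ∈ W, ¬ heavy p m n L j v = true) {i : ℕ} (hi : i + 1 ≤ p.k) :
    p.R * ((L.countP fun e => decide (e.length = i + 1)) * p.K ^ (p.k - (i + 1))) ≤
      2 * m + p.R * (Λ * (i * ((L.countP fun e => decide (e.length = i)) * p.K ^ (p.k - i)))) := by
  set S : Finset V := W.filter fun u => m ≤ deg L i u * p.K ^ (p.k - i) * n with hS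
  set κ := p.K ^ (p.k - (i + 1)) with hκ
  have h1 : (L.countP fun e => decide (e.length = i + 1)) ≤
      (∑ v ∈ W, L.countP (eligible p m n L (i + 1) v)) + ∑ u ∈ S, deg L (i + 1) u := by
    refine (countP_le_add (d := fun e => decide (e.length = i + 1) &&
      decide (∀ u ∈ e, u ∉ S)) (e := fun e => decide (e.length = i + 1) &&
      decide (∃ u ∈ e, u ∈ S)) fun e _ he => ?_).trans
      (add_le_add (countP_le_sum fun e he hc => ?_) (countP_le_sum fun e he hc => ?_))
    · by_cases hS : ∃ u ∈ e, u ∈ S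
      · right; simp only [decide_eq_true_eq] at he; simp [he, hS]
      · left; push Not at hS; simp only [decide_eq_true_eq] at he; simpa [he] using hS
    · simp only [Bool.and_eq_true, decide_eq_true_eq] at hc
      have hpos : 0 < e.length := by omega
      obtain ⟨v, hv⟩ := List.exists_mem_of_length_pos hpos
      refine ⟨v, h.subset e he v hv, eligible_iff.2 ⟨hc.1, hv, fun u hu => .inr ?_⟩⟩
      have := hc.2 u hu
      rw [hS, Finset.mem_filter] at this
      push Not at this
      exact this (h.subset e he u hu)
    · simp only [Bool.and_eq_true, decide_eq_true_eq] at hc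
      obtain ⟨u, hu, huS⟩ := hc.2
      exact ⟨u, huS, by simp [hc.1, hu]⟩
  have h2 : ∀ v ∈ W, n * p.R * κ * L.countP (eligible p m n L (i + 1) v) ≤ m := by
    intro v hv
    have := hs (i + 1) (by omega) hi v hv
    simp only [heavy, decide_eq_true_eq, not_le] at this
    calc _ = L.countP (eligible p m n L (i + 1) v) * (p.R * κ) * n := by ring
      _ ≤ m := this.le
  have h3 : n * p.R * κ * ∑ v ∈ W, L.countP (eligible p m n L (i + 1) v) ≤ 2 * n * m := by
    rw [Finset.mul_sum]
    refine (Finset.sum_le_card_nsmul _ _ m h2).trans ?_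
    rw [smul_eq_mul]
    gcongr
  have h4 : n * p.R * κ * ∑ u ∈ S, deg L (i + 1) u ≤ p.R * (Λ * (S.card * m)) := by
    have : n * κ * ∑ u ∈ S, deg L (i + 1) u ≤ S.card * (Λ * m) := by
      rw [Finset.mul_sum]
      refine (Finset.sum_le_card_nsmul _ _ (Λ * m) fun u _ => ?_).trans (by simp)
      have := h.deg_le (i + 1) (by omega) hi u
      calc _ = deg L (i + 1) u * κ * n := by ring
        _ ≤ _ := this
    calc _ = p.R * (n * κ * ∑ u ∈ S, deg L (i + 1) u) := by ring
      _ ≤ p.R * (S.card * (Λ * m)) := by gcongr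
      _ = _ := by ring
  -- Every saturated vertex has normalised degree at least `m`, while the degrees at level `i` sum
  -- to `i` times the number of clauses of size `i`.
  have h5 : S.card * m ≤ n * (i * ((L.countP fun e => decide (e.length = i)) * p.K ^ (p.k - i))) := by
    have h6 : S.card * m ≤ ∑ u ∈ S, deg L i u * p.K ^ (p.k - i) * n := by
      rw [← smul_eq_mul]
      exact Finset.card_nsmul_le_sum _ _ _ fun u hu => (Finset.mem_filter.1 hu).2
    have h7 : ∑ u ∈ S, deg L i u ≤ ∑ u ∈ W, deg L i u :=
      Finset.sum_le_sum_of_subset (Finset.filter_subset _ _)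
    rw [sum_deg h.nodup h.subset] at h7
    calc S.card * m ≤ (∑ u ∈ S, deg L i u) * p.K ^ (p.k - i) * n := by
          rwa [Finset.sum_mul, Finset.sum_mul]
      _ ≤ (i * L.countP fun e => decide (e.length = i)) * p.K ^ (p.k - i) * n := by gcongr
      _ = _ := by ring
  refine Nat.le_of_mul_le_mul_left ?_ hn
  calc n * (p.R * ((L.countP fun e => decide (e.length = i + 1)) * κ))
      = n * p.R * κ * L.countP fun e => decide (e.length = i + 1) := by ring
    _ ≤ n * p.R * κ * ((∑ v ∈ W, L.countP (eligible p m n L (i + 1) v)) +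
        ∑ u ∈ S, deg L (i + 1) u) := by gcongr
    _ ≤ 2 * n * m + p.R * (Λ * (S.card * m)) := by rw [mul_add]; gcongr
    _ ≤ 2 * n * m + p.R * (Λ * (n * (i * ((L.countP fun e => decide (e.length = i)) *
        p.K ^ (p.k - i))))) := by gcongr
    _ = _ := by ring

theorem Spread.count_level (h : Spread p m n Λ W L) (hn : 0 < n) (hΛ : 1 ≤ Λ)
    (hW : W.card ≤ 2 * n)
    (hs : ∀ j, 1 ≤ j → j ≤ p.k → ∀ v ∈ W, ¬ heavy p m n L j v = true) {i : ℕ} (hi : i + 1 ≤ p.k) :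
    p.R * ((L.countP fun e => decide (e.length = i + 1)) * p.K ^ (p.k - (i + 1))) ≤
      2 * m * (i + 1) * (Λ * p.k) ^ i := by
  induction i with
  -- At `i = 0` the factor `i` removes the contribution of saturated vertices.
  | zero => simpa using h.count_step hn hW hs hi
  | succ i ih =>
    have h1 := ih (by omega)
    have h2 := h.count_step hn hW hs hi
    have h3 : 1 ≤ (Λ * p.k) ^ (i + 1) := Nat.one_le_pow _ _ (Nat.mul_pos hΛ (by omega))
    set A := (L.countP fun e => decide (e.length = i + 1)) * p.K ^ (p.k - (i + 1))
    refine h2.trans ?_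
    calc 2 * m + p.R * (Λ * ((i + 1) * A)) = 2 * m * 1 + Λ * (i + 1) * (p.R * A) := by ring
      _ ≤ 2 * m * (Λ * p.k) ^ (i + 1) + Λ * p.k * (2 * m * (i + 1) * (Λ * p.k) ^ i) := by
        gcongr; omega
      _ = _ := by ring

/-- If no vertex is heavy, then few clauses are left. -/
theorem Spread.count_le (h : Spread p m n Λ W L) (hn : 0 < n) (hΛ : 1 ≤ Λ)
    (hW : W.card ≤ 2 * n) (hk : 1 ≤ p.k) (hK : 1 ≤ p.K) {D : ℕ}
    (hR : p.R = 2 * p.k ^ 2 * (Λ * p.k) ^ p.k * D)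
    (hs : ∀ j, 1 ≤ j → j ≤ p.k → ∀ v ∈ W, ¬ heavy p m n L j v = true) :
    (L.countP fun e => decide (e ≠ [])) * D ≤ m := by
  -- There are `k` levels, and by `count_level` each contributes at most `2 m k (Λ k) ^ k`, divided
  -- by `R`. Hence `R = M D` suffices.
  set M := 2 * p.k ^ 2 * (Λ * p.k) ^ p.k with hM
  have hMpos : 0 < M := by positivity
  have h1 : (L.countP fun e => decide (e ≠ [])) ≤
      ∑ i ∈ Finset.range p.k, L.countP fun e => decide (e.length = i + 1) := by
    refine countP_le_sum fun e he hne => ⟨e.length - 1, ?_, ?_⟩ <;>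
    · have h2 := h.length_le e he
      have h3 : 0 < e.length := List.length_pos_iff.2 (by simpa using hne)
      simp
      omega
  have h2 : p.R * (L.countP fun e => decide (e ≠ [])) ≤ M * m := by
    calc p.R * (L.countP fun e => decide (e ≠ []))
        ≤ p.R * ∑ i ∈ Finset.range p.k, L.countP fun e => decide (e.length = i + 1) := by gcongr
      _ = ∑ i ∈ Finset.range p.k, p.R * L.countP fun e => decide (e.length = i + 1) :=
          Finset.mul_sum _ _ _
      _ ≤ (Finset.range p.k).card • (2 * m * p.k * (Λ * p.k) ^ p.k) := by
          refine Finset.sum_le_card_nsmul _ _ _ fun i hi => ?_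
          have hi := Finset.mem_range.1 hi
          refine le_trans ?_ ((h.count_level hn hΛ hW hs (i := i) (by omega)).trans ?_)
          · gcongr
            exact Nat.le_mul_of_pos_right _ (by positivity)
          · gcongr
            · omega
            · exact Nat.mul_pos hΛ hk
      _ = M * m := by rw [Finset.card_range, smul_eq_mul]; ring
  refine Nat.le_of_mul_le_mul_left ?_ hMpos
  calc M * ((L.countP fun e => decide (e ≠ [])) * D) = p.R * L.countP fun e => decide (e ≠ []) := by
        rw [hR]; ring
    _ ≤ M * m := h2

/-! #### The run with an independent set as the oracle -/

/-- The properties of a state `(X, L)` of the procedure, run on `F` with an independent set `I` as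
the oracle, where `G` is the set of the vertices for which the oracle has answered yes. -/
structure Reachable (p : Params) (m n Λ q : ℕ) (W : Finset V) (I : V → Prop) (F : List (List V))
    (s : State V) (G : Finset V) : Prop where
  spread : Spread p m n Λ W s.2
  track : List.Forall₂ (fun E e => (e = [] → ∃ u ∈ E, u ∈ s.1) ∧
    (e ≠ [] → ∀ u ∈ E, u ∉ e → I u) ∧ e ⊆ E) F s.2
  disjoint : ∀ u ∈ s.1, ¬ I u
  fresh : ∀ e ∈ s.2, ∀ u ∈ e, u ∉ s.1
  nodup : s.1.Nodup
  subset : ∀ u ∈ s.1, u ∈ W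
  mem_of_mem : ∀ u ∈ G, I u
  card_le : G.card * (m * q) ≤ p.R * (n * potential p s.2 + s.1.length * (p.k * (Λ * m)))

variable {q : ℕ} {s : State V} {G : Finset V} {j : ℕ} {v : V}

theorem forall₂_map {β : Type*} {P Q : β → β → Prop} {f : β → β} {F L : List β}
    (h : List.Forall₂ P F L) (hf : ∀ a b, a ∈ F → b ∈ L → P a b → Q a (f b)) :
    List.Forall₂ Q F (L.map f) := by
  induction h with
  | nil => exact .nil
  | cons h _ ih =>
    exact .cons (hf _ _ (by simp) (by simp) h) (ih fun a b ha hb => hf a b (by simp [ha]) (by simp [hb]))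

theorem forall₂_exists {β : Type*} {P : β → β → Prop} {F L : List β} (h : List.Forall₂ P F L)
    {b : β} (hb : b ∈ L) : ∃ a ∈ F, P a b := by
  induction h with
  | nil => simp at hb
  | cons h _ ih =>
    rcases List.mem_cons.1 hb with rfl | hb
    · exact ⟨_, by simp, h⟩
    · obtain ⟨a, ha, h'⟩ := ih hb
      exact ⟨a, by simp [ha], h'⟩

/-- A yes shortens at least `m / (R κ n)` clauses, where `κ = K ^ (k - j)`, and each of them gains
`κ q`. So `R n` times the potential grows by at least `m q`, which pays for the new element of `G`.
-/
theorem Reachable.yes (h : Reachable p m n Λ q W I F s G) (hK : p.K = q + 1) (hΛ : 2 ≤ Λ)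
    (hI : ∀ E ∈ F, ∃ u ∈ E, ¬ I u) (hj : 1 ≤ j) (hjk : j ≤ p.k)
    (hh : heavy p m n s.2 j v = true) (hv : I v) :
    Reachable p m n Λ q W I F (s.1, removeFrom (eligible p m n s.2 j v) v s.2) (insert v G) := by
  -- The vertex of the original clause `E` outside `I` cannot have been deleted, since deleted
  -- vertices lie in `I`, and it is not `v`.
  have hne : ∀ e ∈ s.2, e ≠ [] → v ∈ e → e.filter (fun u => !decide (u = v)) ≠ [] := by
    intro e he hne hve hnil
    obtain ⟨E, hE, hEe⟩ := forall₂_exists h.track he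
    obtain ⟨u, hu, huI⟩ := hI E hE
    have h1 : u ∈ e := by
      by_contra hue
      exact huI (hEe.2.1 hne u hu hue)
    have h2 : u ≠ v := by rintro rfl; exact huI hv
    have : u ∈ e.filter (fun u => !decide (u = v)) := List.mem_filter.2 ⟨h1, by simp [h2]⟩
    rw [hnil] at this
    simp at this
  refine ⟨h.spread.removeFrom (by omega) hΛ j v, forall₂_map h.track fun E e hE he hEe => ?_,
    h.disjoint, ?_, h.nodup, h.subset, ?_, ?_⟩
  · by_cases hel : eligible p m n s.2 j v e = true
    · have hel' := eligible_iff.1 hel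
      have hne' := List.ne_nil_of_mem hel'.2.1
      rw [if_pos hel]
      refine ⟨fun h0 => absurd h0 (hne e he hne' hel'.2.1), fun _ u hu hue => ?_,
        fun u hu => hEe.2.2 (List.mem_filter.1 hu).1⟩
      by_cases huv : u = v
      · rw [huv]; exact hv
      · exact hEe.2.1 hne' u hu fun h1 => hue (List.mem_filter.2 ⟨h1, by simp [huv]⟩)
    · rw [if_neg hel]; exact hEe
  · intro e' he' u hu
    obtain ⟨e, he, rfl⟩ := List.mem_map.1 he'
    refine h.fresh e he u ?_
    split_ifs at hu
    · exact (List.mem_filter.1 hu).1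
    · exact hu
  · intro u hu
    rcases Finset.mem_insert.1 hu with rfl | hu
    · exact hv
    · exact h.mem_of_mem u hu
  · have h1 := potential_removeFrom p (c := eligible p m n s.2 j v) (v := v) (L := s.2) (j := j - 1)
      hK (by omega) fun e he hel => by
        have hel' := eligible_iff.1 hel
        have h1 : (e.filter fun u => !decide (u = v)) = e.erase v := by
          rw [(h.spread.nodup e he).erase_eq_filter]
          refine List.filter_congr fun x _ => ?_
          by_cases hx : x = v <;> simp [hx]
        refine ⟨by omega, ?_, hne e he (List.ne_nil_of_mem hel'.2.1) hel'.2.1⟩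
        rw [h1, List.length_erase_of_mem hel'.2.1, hel'.1]
    rw [Nat.sub_add_cancel hj] at h1
    simp only [heavy, decide_eq_true_eq] at hh
    -- Only an inequality: `v` stays in clauses that are not eligible, so it can be queried again.
    have h2 : (insert v G).card ≤ G.card + 1 := Finset.card_insert_le _ _
    set g := s.2.countP (eligible p m n s.2 j v)
    set κ := p.K ^ (p.k - j)
    calc (insert v G).card * (m * q) ≤ (G.card + 1) * (m * q) := by gcongr
      _ = G.card * (m * q) + m * q := by ring
      _ ≤ p.R * (n * potential p s.2 + s.1.length * (p.k * (Λ * m))) + g * (p.R * κ) * n * q := by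
          refine add_le_add h.card_le ?_
          gcongr
      _ = p.R * (n * (potential p s.2 + g * (κ * q)) + s.1.length * (p.k * (Λ * m))) := by ring
      _ ≤ _ := by gcongr

/-- The loss of potential is the weight at `v`, which the degree bounds control. The length of the
recorded list grows by one and compensates for it in `card_le`. -/
theorem Reachable.no (h : Reachable p m n Λ q W I F s G) (hm : 0 < m)
    (hh : heavy p m n s.2 j v = true) (hv : ¬ I v) (hvW : v ∈ W) :
    Reachable p m n Λ q W I F (v :: s.1, SpreadSAT.discard v s.2) G := by
  refine ⟨h.spread.discard v, forall₂_map h.track fun E e hE he hEe => ?_, ?_, ?_, ?_, ?_,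
    h.mem_of_mem, ?_⟩
  · by_cases hve : v ∈ e
    · simp only [hve, decide_true, if_true, ne_eq, not_true_eq_false, false_imp_iff, true_and,
        forall_const]
      exact ⟨⟨v, hEe.2.2 hve, by simp⟩, by simp⟩
    · simp only [hve, decide_false, if_false, Bool.false_eq_true]
      refine ⟨fun h0 => ?_, hEe.2⟩
      obtain ⟨u, hu, hux⟩ := hEe.1 h0
      exact ⟨u, hu, by simp [hux]⟩
  · intro u hu
    rcases List.mem_cons.1 hu with rfl | hu
    · exact hv
    · exact h.disjoint u hu
  · intro e' he' u hu
    obtain ⟨e, he, rfl⟩ := List.mem_map.1 he'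
    by_cases hve : v ∈ e
    · simp [hve] at hu
    · simp only [hve, decide_false, if_false, Bool.false_eq_true] at hu
      simp only [List.mem_cons, not_or]
      exact ⟨by rintro rfl; exact hve hu, h.fresh e he u hu⟩
  -- A heavy vertex lies in a current clause, and such vertices have not been recorded before.
  · obtain ⟨e, he, hel⟩ := exists_eligible hm hh
    exact List.nodup_cons.2 ⟨h.fresh e he v (eligible_iff.1 hel).2.1, h.nodup⟩
  · intro u hu
    rcases List.mem_cons.1 hu with rfl | hu
    · exact hvW
    · exact h.subset u hu
  · refine h.card_le.trans ?_
    have h1 := potential_discard p s.2 v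
    have h2 := h.spread.weightAt_le v
    rw [List.length_cons]
    refine Nat.mul_le_mul_left _ ?_
    calc n * potential p s.2 + s.1.length * (p.k * (Λ * m))
        ≤ n * (potential p (SpreadSAT.discard v s.2) + weightAt p s.2 v) +
            s.1.length * (p.k * (Λ * m)) := by gcongr
      _ = n * potential p (SpreadSAT.discard v s.2) + s.1.length * (p.k * (Λ * m)) +
            n * weightAt p s.2 v := by ring
      _ ≤ n * potential p (SpreadSAT.discard v s.2) + s.1.length * (p.k * (Λ * m)) +
            p.k * (Λ * m) := by gcongr
      _ = _ := by ring

end Containers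

/-! ### Fingerprints and the container theorem -/

section Containers

variable {V : Type*} [DecidableEq V] {p : Params} {m n Λ q : ℕ} {I : V → Prop}
  {F : List (List V)}

/-- Some set `G` of queried members of the independent set `I` determines the run of the procedure
on the oracle `I`. -/
theorem Reachable.exists_run {W : Finset V} (hK : p.K = q + 1) (hΛ : 2 ≤ Λ) (hm : 0 < m)
    (hI : ∀ E ∈ F, ∃ u ∈ E, ¬ I u) (l : List (ℕ × V))
    (hl : ∀ a ∈ l, (1 ≤ a.1 ∧ a.1 ≤ p.k) ∧ a.2 ∈ W) {s : State V} {G : Finset V}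
    (h : Reachable p m n Λ q W I F s G) :
    ∃ s' G', Reachable p m n Λ q W I F s' G' ∧ G ⊆ G' ∧
      ∀ O : V → Bool, (∀ v ∈ W, O v = true ↔ v ∈ G') →
        l.foldl (fun s a => act p m n O s a.1 a.2) s = s' := by
  induction l generalizing s G with
  | nil => exact ⟨s, G, h, subset_rfl, fun _ _ => rfl⟩
  | cons a l ih =>
    obtain ⟨⟨h1, h2⟩, h3⟩ := hl a (by simp)
    have hl' := fun b hb => hl b (List.mem_cons_of_mem a hb)
    by_cases hh : heavy p m n s.2 a.1 a.2 = true
    -- The final set `G'` contains every vertex with answer yes and lies inside `I`. An oracle that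
    -- agrees with `G'` on `W` therefore repeats every answer of `I`, although it may differ from
    -- `I` on vertices that are never queried.
    · by_cases hv : I a.2
      · obtain ⟨s', G', hr, hG, hO⟩ := ih hl' (h.yes hK hΛ hI h1 h2 hh hv)
        refine ⟨s', G', hr, (Finset.subset_insert _ _).trans hG, fun O hOG => ?_⟩
        rw [List.foldl_cons, act, if_pos hh,
          if_pos ((hOG _ h3).2 (hG (Finset.mem_insert_self _ _)))]
        exact hO O hOG
      · obtain ⟨s', G', hr, hG, hO⟩ := ih hl' (h.no hm hh hv h3)
        refine ⟨s', G', hr, hG, fun O hOG => ?_⟩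
        rw [List.foldl_cons, act, if_pos hh,
          if_neg fun hOv => hv (hr.mem_of_mem _ ((hOG _ h3).1 hOv))]
        exact hO O hOG
    · obtain ⟨s', G', hr, hG, hO⟩ := ih hl' h
      refine ⟨s', G', hr, hG, fun O hOG => ?_⟩
      rw [List.foldl_cons, act_of_not_heavy hh]
      exact hO O hOG

theorem iterate_pass_eq (O : V → Bool) (W : List V) (T : ℕ) (s : State V) :
    (pass p m n O W)^[T] s = ((List.replicate T (schedule p.k W)).flatten).foldl
      (fun s a => act p m n O s a.1 a.2) s := by
  induction T generalizing s with
  | zero => rfl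
  | succ T ih =>
    rw [Function.iterate_succ_apply, ih, List.replicate_succ, List.flatten_cons, List.foldl_append,
      pass_eq]

/-- Both terms in `card_le` are at most `2 n k Λ m`: the potential is bounded by the weights at the
at most `2 n` vertices, and the recorded vertices are distinct members of `W`. This is the origin of
the `4` in `q`. -/
theorem Reachable.card_mul_le {W : Finset V} {s : State V} {G : Finset V}
    (h : Reachable p m n Λ q W I F s G) (hm : 0 < m) (hΛ : 1 ≤ Λ) (hk : 1 ≤ p.k) (hR : 1 ≤ p.R)
    (hW : W.card ≤ 2 * n) {B : ℕ} (hq : q = 4 * p.k * Λ * p.R * B) : G.card * B ≤ n := by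
  have h1 : n * potential p s.2 ≤ 2 * n * (p.k * (Λ * m)) := by
    calc n * potential p s.2 ≤ n * ∑ u ∈ W, weightAt p s.2 u := by
          gcongr; exact potential_le_sum p h.spread.subset
      _ = ∑ u ∈ W, n * weightAt p s.2 u := Finset.mul_sum _ _ _
      _ ≤ W.card • (p.k * (Λ * m)) := Finset.sum_le_card_nsmul _ _ _ fun u _ =>
          h.spread.weightAt_le u
      _ ≤ _ := by rw [smul_eq_mul]; gcongr
  have h2 : s.1.length ≤ 2 * n := by
    rw [← List.toFinset_card_of_nodup h.nodup]
    exact (Finset.card_le_card fun u hu => h.subset u (List.mem_toFinset.1 hu)).trans hW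
  have hpos : 0 < 4 * p.k * Λ * p.R * m := by positivity
  refine Nat.le_of_mul_le_mul_left ?_ hpos
  calc 4 * p.k * Λ * p.R * m * (G.card * B) = G.card * (m * q) := by rw [hq]; ring
    _ ≤ p.R * (n * potential p s.2 + s.1.length * (p.k * (Λ * m))) := h.card_le
    _ ≤ p.R * (2 * n * (p.k * (Λ * m)) + 2 * n * (p.k * (Λ * m))) := by gcongr
    _ = _ := by ring

/-- The container theorem: for every independent set `I` there is a small set `G`, such that the
procedure with the oracle `G` records a set of vertices outside `I` that meets almost all
clauses. -/
theorem exists_fingerprint {W : List V} {B D T : ℕ} (hm : 0 < m) (hn : 0 < n) (hΛ : 2 ≤ Λ)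
    (hk : 1 ≤ p.k) (hD : 1 ≤ D) (hW : W.length ≤ 2 * n)
    (hR : p.R = 2 * p.k ^ 2 * (Λ * p.k) ^ p.k * D) (hK : p.K = 4 * p.k * Λ * p.R * B + 1)
    (hF : Spread p m n Λ W.toFinset F) (hI : ∀ E ∈ F, ∃ u ∈ E, ¬ I u) (hT : volume F ≤ T) :
    ∃ G : Finset V, G.card * B ≤ n ∧ ∀ O : V → Bool, (∀ v ∈ W, O v = true ↔ v ∈ G) →
      (∀ u ∈ ((pass p m n O W)^[T] ([], F)).1, ¬ I u) ∧
      F.countP (fun E => decide (∀ u ∈ E, u ∉ ((pass p m n O W)^[T] ([], F)).1)) * D ≤ m := by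
  have hW' : W.toFinset.card ≤ 2 * n := (List.toFinset_card_le W).trans hW
  have hR1 : 1 ≤ p.R := by
    rw [hR]
    have : 0 < Λ := by omega
    have : 0 < p.k := hk
    have : 0 < D := hD
    exact Nat.one_le_iff_ne_zero.2 (by positivity)
  have h0 : Reachable p m n Λ (4 * p.k * Λ * p.R * B) W.toFinset I F ([], F) ∅ := by
    refine ⟨hF, ?_, by simp, by simp, by simp, by simp, by simp, by simp⟩
    refine List.forall₂_same.2 fun E hE => ⟨?_, fun _ u hu hu' => absurd hu hu', fun _ h => h⟩
    rintro rfl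
    obtain ⟨u, hu, _⟩ := hI _ hE
    simp at hu
  obtain ⟨s', G, hr, -, hO⟩ := Reachable.exists_run (W := W.toFinset) hK hΛ hm hI
    ((List.replicate T (schedule p.k W)).flatten) (fun a ha => by
      obtain ⟨l, hl, ha⟩ := List.mem_flatten.1 ha
      rw [List.eq_of_mem_replicate hl] at ha
      simpa using mem_schedule.1 ha) h0
  refine ⟨G, hr.card_mul_le hm (by omega) hk hR1 hW' rfl, fun O hOG => ?_⟩
  have hs := hO O (by simpa using hOG)
  rw [← iterate_pass_eq] at hs
  have hstuck := fun (j : ℕ) (hj : 1 ≤ j) (hjk : j ≤ p.k) v (hv : v ∈ W.toFinset) =>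
    not_heavy_of_iterate (p := p) (n := n) hm O W T ([], F) hT hj hjk (List.mem_toFinset.1 hv)
  rw [hs] at hstuck ⊢
  refine ⟨hr.disjoint, le_trans ?_
    (hr.spread.count_le hn (by omega) hW' hk (by omega) hR hstuck)⟩
  gcongr
  -- A clause that misses the recorded vertices cannot have become empty, by `track`, so it is
  -- counted among the surviving clauses.
  have htr := hr.track
  generalize s'.2 = L at htr
  clear hr hs hO h0 hF hI hT
  induction htr with
  | nil => simp
  | @cons E e F' L' hE _ ih =>
    rw [List.countP_cons, List.countP_cons]
    refine add_le_add ih ?_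
    by_cases he : e = []
    · obtain ⟨u, hu, hux⟩ := hE.1 he
      have : ¬ ∀ u ∈ E, u ∉ s'.1 := fun h => h u hu hux
      simp [this]
    · simp only [he, ne_eq, not_false_eq_true, decide_true, if_true]
      split_ifs <;> simp

/-- At the start all clauses have size `k`, so the degrees at lower levels vanish and the usual
degree bound is the only condition on degrees. -/
theorem Spread.initial {W : Finset V} (hnd : ∀ E ∈ F, E.Nodup) (hW : ∀ E ∈ F, ∀ u ∈ E, u ∈ W)
    (hlen : ∀ E ∈ F, E.length = p.k)
    (hdeg : ∀ u, (F.countP fun E => decide (u ∈ E)) * n ≤ Λ * m)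
    (hcodeg : ∀ u v, u ≠ v →
      (F.countP fun E => decide (u ∈ E) && decide (v ∈ E)) * p.K ^ p.k * n ≤ m) :
    Spread p m n Λ W F := by
  refine ⟨hnd, hW, fun E hE => (hlen E hE).le, fun j _ hjk u => ?_, hcodeg⟩
  rcases hjk.eq_or_lt with rfl | hjk
  · rw [Nat.sub_self, pow_zero, mul_one]
    refine le_trans ?_ (hdeg u)
    gcongr
    refine List.countP_mono_left fun E _ h => ?_
    simp only [Bool.and_eq_true] at h
    exact h.2
  · have : deg F j u = 0 := by
      refine List.countP_eq_zero.2 fun E hE h => ?_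
      simp only [Bool.and_eq_true, decide_eq_true_eq] at h
      have := hlen E hE
      omega
    simp [this]

end Containers

/-! ### Enumeration of small sets -/

section Choices

variable {V : Type*}

/-- Add to a list of sets with budgets the sets that are obtained by inserting `x`, at the
price `B`. -/
def extend (B : ℕ) (x : V) (S : List (List V × ℕ)) : List (List V × ℕ) :=
  S.foldl (fun S' e => if decide (B ≤ e.2) then (x :: e.1, e.2 - B) :: S' else S') S

/-- The subsets `G` of `W` with `B |G| ≤ n`, with the remaining budgets `n - B |G|`. -/
def choices (B n : ℕ) (W : List V) : List (List V × ℕ) :=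
  W.foldl (fun S x => extend B x S) [([], n)]

theorem mem_extend {B : ℕ} {x : V} {S : List (List V × ℕ)} {e : List V × ℕ} :
    e ∈ extend B x S ↔ e ∈ S ∨ ∃ d ∈ S, B ≤ d.2 ∧ e = (x :: d.1, d.2 - B) := by
  have key : ∀ S S' : List (List V × ℕ), e ∈ S.foldl (fun S' e => if decide (B ≤ e.2) then
      (x :: e.1, e.2 - B) :: S' else S') S' ↔
        e ∈ S' ∨ ∃ d ∈ S, B ≤ d.2 ∧ e = (x :: d.1, d.2 - B) := by
    intro S
    induction S with
    | nil => simp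
    | cons d S ih =>
      intro S'
      rw [List.foldl_cons, ih]
      by_cases h : B ≤ d.2
      · simp only [h, decide_true, if_true, List.mem_cons, exists_eq_or_imp, true_and]
        tauto
      · simp [h]
  exact key S S

theorem choices_append (B n : ℕ) (W : List V) (x : V) :
    choices B n (W ++ [x]) = extend B x (choices B n W) := by
  rw [choices, List.foldl_append]; rfl

theorem mem_choices {B n : ℕ} {W : List V} {c : V → Bool} (h : W.countP c * B ≤ n) :
    ((W.filter c).reverse, n - W.countP c * B) ∈ choices B n W := by
  induction W using List.reverseRecOn with
  | nil => simp [choices]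
  | append_singleton W x ih =>
    rw [choices_append, mem_extend]
    rw [List.countP_append, add_mul] at h
    have h1 := ih (by omega)
    by_cases hx : c x = true
    · right
      refine ⟨_, h1, ?_, ?_⟩
      · simp only [List.countP_cons, List.countP_nil, hx, if_true] at h
        simp only
        omega
      · simp only [List.filter_append, List.filter_cons, hx, if_true, List.filter_nil,
          List.reverse_append, List.reverse_cons, List.reverse_nil, List.nil_append,
          List.cons_append, List.countP_append, List.countP_cons, List.countP_nil, add_mul]
        congr 1
        omega
    · left
      simpa [List.filter_append, List.filter_cons, hx, List.countP_append] using h1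

theorem le_of_mem_choices {B n : ℕ} {W : List V} {e : List V × ℕ} (h : e ∈ choices B n W) :
    e.2 ≤ n := by
  induction W using List.reverseRecOn generalizing e with
  | nil => simp [choices] at h; simp [h]
  | append_singleton W x ih =>
    rw [choices_append, mem_extend] at h
    rcases h with h | ⟨d, hd, _, rfl⟩
    · exact ih h
    · have := ih hd; simp only; omega

/-- Weigh a set with remaining budget `b` by `θ ^ b`. Inserting an element costs `B` and thus
multiplies the weight by `θ ^ (-B)`. -/
theorem sum_extend {θ : ℝ} (hθ : 0 < θ) (B : ℕ) (x : V) (S : List (List V × ℕ)) :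
    ((extend B x S).map fun e => θ ^ e.2).sum ≤
      (1 + (θ ^ B)⁻¹) * (S.map fun e => θ ^ e.2).sum := by
  have key : ∀ S S' : List (List V × ℕ), ((S.foldl (fun S' e => if decide (B ≤ e.2) then
      (x :: e.1, e.2 - B) :: S' else S') S').map fun e => θ ^ e.2).sum ≤
        (S'.map fun e => θ ^ e.2).sum + (θ ^ B)⁻¹ * (S.map fun e => θ ^ e.2).sum := by
    intro S
    induction S with
    | nil => simp
    | cons d S ih =>
      intro S'
      rw [List.foldl_cons]
      refine (ih _).trans ?_
      rw [List.map_cons, List.sum_cons, mul_add]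
      have hpos : 0 ≤ (θ ^ B)⁻¹ * θ ^ d.2 := by positivity
      by_cases h : B ≤ d.2
      · simp only [h, decide_true, if_true, List.map_cons, List.sum_cons]
        have : θ ^ (d.2 - B) = (θ ^ B)⁻¹ * θ ^ d.2 := by
          rw [pow_sub₀ _ hθ.ne' h, mul_comm]
        rw [this]
        linarith
      · simp only [h, decide_false, if_false, Bool.false_eq_true]
        linarith
  refine (key S S).trans (le_of_eq ?_)
  ring

/-- For `θ ≥ 1` every entry weighs at least `1`. The initial list weighs `θ ^ n`, and each element
of `W` contributes a factor `1 + θ ^ (-B)`. -/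
theorem length_choices_le {θ : ℝ} (hθ : 1 ≤ θ) (B n : ℕ) (W : List V) :
    ((choices B n W).length : ℝ) ≤ θ ^ n * (1 + (θ ^ B)⁻¹) ^ W.length := by
  have h1 : ∀ S : List (List V × ℕ), (S.length : ℝ) ≤ (S.map fun e => θ ^ e.2).sum := by
    intro S
    induction S with
    | nil => simp
    | cons d S ih =>
      have : 1 ≤ θ ^ d.2 := one_le_pow₀ hθ
      simp only [List.length_cons, List.map_cons, List.sum_cons, Nat.cast_add, Nat.cast_one]
      linarith
  refine (h1 _).trans ?_
  induction W using List.reverseRecOn with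
  | nil => simp [choices]
  | append_singleton W x ih =>
    rw [choices_append, List.length_append, List.length_singleton, pow_succ]
    have hpos : 0 < θ := by linarith
    refine (sum_extend hpos B x _).trans ?_
    have : 0 ≤ 1 + (θ ^ B)⁻¹ := by positivity
    nlinarith [mul_le_mul_of_nonneg_left ih this]

theorem length_extend_le (B : ℕ) (x : V) (S : List (List V × ℕ)) :
    S.length ≤ (extend B x S).length := by
  have key : ∀ S S' : List (List V × ℕ), S'.length ≤ (S.foldl (fun S' e => if decide (B ≤ e.2) then
      (x :: e.1, e.2 - B) :: S' else S') S').length := by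
    intro S
    induction S with
    | nil => simp
    | cons d S ih =>
      intro S'
      rw [List.foldl_cons]
      refine le_trans ?_ (ih _)
      split_ifs <;> simp
  exact key S S

/-- Bounds the intermediate lists of the enumeration by the final one, which is needed for its
running time. -/
theorem length_choices_mono (B n : ℕ) (W W' : List V) :
    (choices B n W).length ≤ (choices B n (W ++ W')).length := by
  induction W' using List.reverseRecOn with
  | nil => simp
  | append_singleton W' x ih =>
    rw [← List.append_assoc, choices_append]
    exact ih.trans (length_extend_le B x _)

end Choices

/-! ### The container procedure as a program -/

/-- Literals over variables that are indexed by all natural numbers. -/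
abbrev Lit : Type := Bool × ℕ

/-- Membership of literals in lists is decided by means of decidable equality. -/
instance Lit.instBEq : BEq Lit := instBEqOfDecidableEq

namespace PolyTime

variable {α β σ : Type*} [TreeCode α] [TreeCode β] [TreeCode σ]

theorem lit_eq {u v : α → Lit} (hu : PolyTime u) (hv : PolyTime v) :
    PolyTime (fun a => decide (u a = v a)) :=
  ((hu.fst.bne hv.fst).not.and (hu.snd.decide_eq hv.snd)).congr_enc fun a => by
    congr 1
    rw [Bool.eq_iff_iff]
    simp [Prod.ext_iff]

theorem lit_mem {u : α → Lit} {l : α → List Lit} (hu : PolyTime u) (hl : PolyTime l) :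
    PolyTime (fun a => decide (u a ∈ l a)) :=
  (hl.any (c := fun a x => decide (u a = x))
    ((hu.comp PolyTime.id.fst).lit_eq PolyTime.id.snd)).congr_enc fun a => by
      congr 1
      rw [Bool.eq_iff_iff]
      simp

variable {p : Params} {m n : α → ℕ} {L : α → List (List Lit)} {u v : α → Lit} {e : α → List Lit}

theorem deg (hL : PolyTime L) (j : ℕ) (hu : PolyTime u) :
    PolyTime (fun a => SpreadSAT.deg (L a) j (u a)) :=
  hL.countP (c := fun a (e : List Lit) => decide (e.length = j) && decide (u a ∈ e))
    ((PolyTime.id.snd.length.decide_eq (const j)).and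
      ((hu.comp PolyTime.id.fst).lit_mem PolyTime.id.snd))

theorem saturated (hm : PolyTime m) (hn : PolyTime n) (hL : PolyTime L) (j : ℕ)
    (hu : PolyTime u) : PolyTime (fun a => SpreadSAT.saturated p (m a) (n a) (L a) j (u a)) :=
  hm.decide_le (((hL.deg j hu).mul (const _)).mul hn)

theorem eligible (hm : PolyTime m) (hn : PolyTime n) (hL : PolyTime L) (j : ℕ)
    (hv : PolyTime v) (he : PolyTime e) :
    PolyTime (fun a => SpreadSAT.eligible p (m a) (n a) (L a) j (v a) (e a)) :=
  (he.length.decide_eq (const j)).and ((hv.lit_mem he).and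
    (he.all (c := fun a u => decide (u = v a) ||
        !SpreadSAT.saturated p (m a) (n a) (L a) (j - 1) u)
      ((PolyTime.id.snd.lit_eq (hv.comp PolyTime.id.fst)).or
        (saturated (hm.comp PolyTime.id.fst) (hn.comp PolyTime.id.fst) (hL.comp PolyTime.id.fst)
          (j - 1) PolyTime.id.snd).not)))

theorem eligible_snd (hm : PolyTime m) (hn : PolyTime n) (hL : PolyTime L) (j : ℕ)
    (hv : PolyTime v) : PolyTime (fun q : α × List Lit =>
      SpreadSAT.eligible p (m q.1) (n q.1) (L q.1) j (v q.1) q.2) :=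
  eligible (hm.comp PolyTime.id.fst) (hn.comp PolyTime.id.fst) (hL.comp PolyTime.id.fst) j
    (hv.comp PolyTime.id.fst) PolyTime.id.snd

theorem heavy (hm : PolyTime m) (hn : PolyTime n) (hL : PolyTime L) (j : ℕ) (hv : PolyTime v) :
    PolyTime (fun a => SpreadSAT.heavy p (m a) (n a) (L a) j (v a)) :=
  hm.decide_le (((hL.countP (eligible_snd hm hn hL j hv)).mul (const _)).mul hn)

variable {O : α → Lit → Bool} {s : α → State Lit}

theorem act (hm : PolyTime m) (hn : PolyTime n) (hO : PolyTime (fun q : α × Lit => O q.1 q.2))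
    (hs : PolyTime s) (j : ℕ) (hv : PolyTime v) :
    PolyTime (fun a => SpreadSAT.act p (m a) (n a) (O a) (s a) j (v a)) := by
  refine (heavy hm hn hs.snd j hv).ite ((hO.comp (PolyTime.id.pair hv)).ite
    (hs.fst.pair (hs.snd.map (f := fun a e => if SpreadSAT.eligible p (m a) (n a) (s a).2 j (v a) e
      then e.filter fun u => !decide (u = v a) else e) ?_))
    ((hv.cons hs.fst).pair (hs.snd.map (f := fun a e => if decide (v a ∈ e) then [] else e) ?_))) hs
  · exact (eligible_snd hm hn hs.snd j hv).ite
      (PolyTime.id.snd.filter (c := fun (q : α × List Lit) u => !decide (u = v q.1))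
        (PolyTime.id.snd.lit_eq (hv.comp PolyTime.id.fst.fst)).not) PolyTime.id.snd
  · exact ((hv.comp PolyTime.id.fst).lit_mem PolyTime.id.snd).ite (const _) PolyTime.id.snd

theorem esize_map_le {f : β → β} (hf : ∀ b, esize (f b) ≤ esize b) (l : List β) :
    esize (l.map f) ≤ esize l := by
  induction l with
  | nil => simp
  | cons b l ih => have := hf b; simp only [List.map_cons, esize_cons]; omega

/-- Clauses only shrink; the only growth comes from recording `v`. The increase does not depend on
the state, so iterated passes stay polynomial. -/
theorem esize_act (p : Params) (m n : ℕ) (O : Lit → Bool) (s : State Lit) (j : ℕ) (v : Lit) :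
    esize (SpreadSAT.act p m n O s j v) ≤ esize s + (esize v + 1) := by
  have h1 : ∀ c, esize (removeFrom c v s.2) ≤ esize s.2 := fun c => esize_map_le (fun e => by
    split_ifs
    · exact esize_sublist List.filter_sublist
    · exact le_rfl) _
  have h2 : esize (discard v s.2) ≤ esize s.2 := esize_map_le (fun e => by
    split_ifs
    · exact esize_sublist (List.nil_sublist _)
    · exact le_rfl) _
  have h3 := h1 (SpreadSAT.eligible p m n s.2 j v)
  simp only [SpreadSAT.act]
  split_ifs
  · simp only [esize_prod] at h3 ⊢; omega
  · simp only [esize_prod, esize_cons] at h2 ⊢; omega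
  · omega

theorem esize_foldl_act (p : Params) (m n : ℕ) (O : Lit → Bool) (l : List ℕ) (s : State Lit)
    (v : Lit) : esize (l.foldl (fun s i => SpreadSAT.act p m n O s (i + 1) v) s) ≤
      esize s + l.length * (esize v + 1) := by
  induction l generalizing s with
  | nil => simp
  | cons j l ih =>
    have h1 := ih (SpreadSAT.act p m n O s (j + 1) v)
    have h2 := esize_act p m n O s (j + 1) v
    rw [List.foldl_cons, List.length_cons, add_mul, one_mul]
    omega

/-- The levels form a fixed list that does not depend on the input, so the actions are composed one
after another, with the level built into the program. -/
theorem foldl_act (hm : PolyTime m) (hn : PolyTime n)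
    (hO : PolyTime (fun q : α × Lit => O q.1 q.2)) (hs : PolyTime s) (l : List ℕ)
    (hv : PolyTime v) : PolyTime (fun a =>
      l.foldl (fun s i => SpreadSAT.act p (m a) (n a) (O a) s (i + 1) (v a)) (s a)) := by
  induction l using List.reverseRecOn with
  | nil => exact hs
  | append_singleton l i ih =>
    simp only [List.foldl_append, List.foldl_cons, List.foldl_nil]
    exact act hm hn hO ih (i + 1) hv

theorem esize_pass (p : Params) (m n : ℕ) (O : Lit → Bool) (W : List Lit) (s : State Lit) :
    esize (SpreadSAT.pass p m n O W s) ≤ esize s + esize W * (p.k * (esize W + 1)) := by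
  have key : ∀ (l : List Lit) (s : State Lit), (∀ v ∈ l, v ∈ W) →
      esize (SpreadSAT.pass p m n O l s) ≤ esize s + l.length * (p.k * (esize W + 1)) := by
    intro l
    induction l with
    | nil => intro s _; simp [SpreadSAT.pass]
    | cons v l ih =>
      intro s hl
      have h1 := ih ((List.range p.k).foldl
        (fun s i => SpreadSAT.act p m n O s (i + 1) v) s) fun u hu => hl u (by simp [hu])
      have h2 := esize_foldl_act p m n O (List.range p.k) s v
      have h3 : p.k * (esize v + 1) ≤ p.k * (esize W + 1) := by
        gcongr; exact esize_le_of_mem (hl v (by simp))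
      rw [List.length_range] at h2
      rw [List.length_cons, add_mul, one_mul]
      simp only [SpreadSAT.pass, List.foldl_cons] at h1 ⊢
      omega
  refine (key W s fun _ h => h).trans ?_
  have := length_lt_esize W
  gcongr

theorem pass {W : α → List Lit} (hm : PolyTime m) (hn : PolyTime n)
    (hO : PolyTime (fun q : α × Lit => O q.1 q.2)) (hW : PolyTime W) (hs : PolyTime s) :
    PolyTime (fun a => SpreadSAT.pass p (m a) (n a) (O a) (W a) (s a)) := by
  refine foldl_of_add (step := fun a s v => (List.range p.k).foldl
    (fun s i => SpreadSAT.act p (m a) (n a) (O a) s (i + 1) v) s) hW hs ?_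
    (B := fun a => p.k * (esize (W a) + 1))
    ((PolyBound.const _).mul (hW.polyBound.add (.const 1))) fun a s v hv => ?_
  · exact foldl_act (hm.comp PolyTime.id.fst) (hn.comp PolyTime.id.fst)
      (O := fun (q : α × Lit × State Lit) => O q.1)
      (hO.comp (PolyTime.id.fst.fst.pair PolyTime.id.snd)) PolyTime.id.snd.snd _
      PolyTime.id.snd.fst
  · refine (esize_foldl_act _ _ _ _ _ _ _).trans ?_
    rw [List.length_range]
    have := esize_le_of_mem hv
    gcongr

end PolyTime

/-- All literals over the first `n` variables. -/
def lits (n : ℕ) : List Lit :=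
  (List.range n).map (fun i => (true, i)) ++ (List.range n).map fun i => (false, i)

/-- The literals that the procedure with the oracle `G` records. -/
def recorded (p : Params) (x : ℕ × List (List Lit)) (G : List Lit) : List Lit :=
  ((pass p x.2.length x.1 (fun v => decide (v ∈ G)) (lits x.1))^[p.k * x.2.length] ([], x.2)).1

/-- The number of clauses that are violated if exactly the variables in `X` are true. -/
def violated (X : List Lit) (F : List (List Lit)) : ℕ :=
  F.countP fun E => E.all fun l => decide ((true, l.2) ∈ X) != l.1

/-- The assignment that is obtained from the set `G`, if it violates at most a fraction `1 / D`
of the clauses. -/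
def attempt (p : Params) (D : ℕ) (x : ℕ × List (List Lit)) (G : List Lit) :
    Option (List Bool) :=
  if decide (violated (recorded p x G) x.2 * D ≤ x.2.length) then
    some ((List.range x.1).map fun i => decide ((true, i) ∈ recorded p x G))
  else none

namespace PolyTime

variable {α : Type*} [TreeCode α]

theorem lits {n : α → ℕ} (hn : PolyTime n) : PolyTime (fun a => SpreadSAT.lits (n a)) :=
  (hn.range.map (f := fun _ i => ((true, i) : Lit)) ((const true).pair PolyTime.id.snd)).append
    (hn.range.map (f := fun _ i => ((false, i) : Lit)) ((const false).pair PolyTime.id.snd))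

theorem recorded (p : Params) {x : α → ℕ × List (List Lit)} {G : α → List Lit}
    (hx : PolyTime x) (hG : PolyTime G) :
    PolyTime (fun a => SpreadSAT.recorded p (x a) (G a)) := by
  have hW := hx.fst.lits
  refine fst (iterate_of_add (f := fun a => p.k * (x a).2.length) (s := fun a => ([], (x a).2))
    (step := fun a => SpreadSAT.pass p (x a).2.length (x a).1 (fun v => decide (v ∈ G a))
      (SpreadSAT.lits (x a).1)) ((const _).mul hx.snd.length) ((const _).pair hx.snd) ?_
    (B := fun a => esize (SpreadSAT.lits (x a).1) * (p.k * (esize (SpreadSAT.lits (x a).1) + 1)))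
    (hW.polyBound.mul ((PolyBound.const _).mul (hW.polyBound.add (.const 1))))
    fun a s => esize_pass _ _ _ _ _ _)
  exact pass (hx.snd.length.comp PolyTime.id.fst) (hx.fst.comp PolyTime.id.fst)
    (O := fun (q : α × State Lit) v => decide (v ∈ G q.1))
    (PolyTime.id.snd.lit_mem (hG.comp PolyTime.id.fst.fst)) (hW.comp PolyTime.id.fst)
    PolyTime.id.snd

theorem violated {X : α → List Lit} {F : α → List (List Lit)} (hX : PolyTime X)
    (hF : PolyTime F) : PolyTime (fun a => SpreadSAT.violated (X a) (F a)) :=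
  hF.countP (c := fun a (E : List Lit) => E.all fun l => decide ((true, l.2) ∈ X a) != l.1)
    (PolyTime.id.snd.all (c := fun (q : α × List Lit) l => decide ((true, l.2) ∈ X q.1) != l.1)
      ((lit_mem ((const true).pair PolyTime.id.snd.snd) (hX.comp PolyTime.id.fst.fst)).bne
        PolyTime.id.snd.fst))

theorem attempt (p : Params) (D : ℕ) {x : α → ℕ × List (List Lit)} {G : α → List Lit}
    (hx : PolyTime x) (hG : PolyTime G) :
    PolyTime (fun a => SpreadSAT.attempt p D (x a) (G a)) := by
  have hX := recorded p hx hG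
  exact ((((hX.violated hx.snd).mul (const D)).decide_le hx.snd.length)).ite
    (some (hx.fst.range.map (f := fun a i => decide ((true, i) ∈ SpreadSAT.recorded p (x a) (G a)))
      (lit_mem ((const true).pair PolyTime.id.snd) (hX.comp PolyTime.id.fst)))) (const _)

end PolyTime

/-! ### The exhaustive search -/

/-- The first successful attempt with one of the small sets of literals. -/
def solve (p : Params) (D B : ℕ) (x : ℕ × List (List Lit)) : Option (List Bool) :=
  (choices B x.1 (lits x.1)).foldl
    (fun r e => if r.isSome then r else attempt p D x e.1) none

theorem foldl_isSome {β σ : Type*} {f : β → Option σ} (l : List β) :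
    (l.foldl (fun r e => if r.isSome then r else f e) none = none ∧ ∀ e ∈ l, f e = none) ∨
      ∃ e ∈ l, f e ≠ none ∧ l.foldl (fun r e => if r.isSome then r else f e) none = f e := by
  induction l using List.reverseRecOn with
  | nil => simp
  | append_singleton l e ih =>
    rw [List.foldl_append, List.foldl_cons, List.foldl_nil]
    rcases ih with ⟨h1, h2⟩ | ⟨d, hd, h1, h2⟩
    · rw [h1]
      by_cases he : f e = none
      · left
        refine ⟨by simp [he], fun d hd => ?_⟩
        rcases List.mem_append.1 hd with hd | hd
        · exact h2 d hd
        · rw [List.mem_singleton.1 hd, he]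
      · exact .inr ⟨e, by simp, he, by simp⟩
    · right
      refine ⟨d, by simp [hd], h1, ?_⟩
      rw [h2, if_pos (Option.isSome_iff_ne_none.2 h1)]

theorem esize_of_mem_choices {B n : ℕ} {W : List Lit} {e : List Lit × ℕ}
    (h : e ∈ choices B n W) : esize e ≤ esize W + (2 * n + 1) + 1 := by
  have h1 : esize e.1 ≤ esize W := by
    induction W using List.reverseRecOn generalizing e with
    | nil => simp [choices] at h; simp [h]
    | append_singleton W x ih =>
      have hW := esize_append W [x]
      rw [choices_append, mem_extend] at h
      simp only [esize_cons, esize_nil] at hW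
      rcases h with h | ⟨d, hd, _, rfl⟩
      · have := ih h; omega
      · have := ih hd; simp only [esize_cons]; omega
  have h2 := le_of_mem_choices h
  simp only [esize_prod, esize_nat]
  omega

/-- The list `S` may be exponentially long, so the time is recorded as linear in its length, with a
factor that is polynomial in the size `b` of single entries. -/
theorem exists_extend_prog (B : ℕ) : ∃ (E : Prog) (q : Polynomial ℕ),
    ∀ (x : Lit) (S : List (List Lit × ℕ)) (b : ℕ), (∀ e ∈ S, esize e ≤ b) →
      E.RunsIn (enc (S, x, S)) (enc (([] : List (List Lit × ℕ)), x, extend B x S))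
        (S.length * (q.eval (esize x + b + 1) + 40) + 2) := by
  obtain ⟨P, r, hP⟩ : PolyTime (fun x : Lit × (List Lit × ℕ) => decide (B ≤ x.2.2)) :=
    (PolyTime.const B).decide_le PolyTime.id.snd.snd
  obtain ⟨Q, s, hQ⟩ : PolyTime (fun x : Lit × (List Lit × ℕ) => (x.1 :: x.2.1, x.2.2 - B)) :=
    (PolyTime.id.fst.cons PolyTime.id.snd.fst).pair (PolyTime.id.snd.snd.sub (.const B))
  let prep : Prog := .pair .head (.seq .tail .head)
  let rest : Prog := .seq .tail .tail
  refine ⟨Prog.overList (.cond (.seq prep P) (.pair (.seq prep Q) rest) rest), r + s,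
    fun x S b hb => ?_⟩
  refine (Prog.overList_runsIn (T := (r + s).eval (esize x + b + 1) + 18) (g := x) S S
    (step := fun S' e => if decide (B ≤ e.2) then (x :: e.1, e.2 - B) :: S' else S')
    fun l₁ e l₂ hl => ?_).mono (by rw [add_assoc])
  set acc := l₁.foldl (fun S' e => if decide (B ≤ e.2) then (x :: e.1, e.2 - B) :: S' else S') S
  have hprep : prep.RunsIn (enc (x, e, acc)) (enc (x, e)) 5 :=
    Prog.RunsIn.pair (s := 1) .head (Prog.RunsIn.seq (s := 1) .tail .head)
  have hrest : rest.RunsIn (enc (x, e, acc)) (enc acc) 3 := Prog.RunsIn.seq (s := 1) .tail .tail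
  have hsize : esize (x, e) ≤ esize x + b + 1 := by
    have := hb e (by simp [hl])
    simp only [esize_prod x, esize_prod (x, e)]
    omega
  have hP' := (hP (x, e)).2.mono (eval_mono r hsize)
  have hQ' := (hQ (x, e)).2.mono (eval_mono s hsize)
  rw [Polynomial.eval_add]
  by_cases h : B ≤ e.2
  · simp only [h, decide_true, if_true] at hP' ⊢
    exact (Prog.RunsIn.cond_cons (hprep.seq hP') ((hprep.seq hQ').pair hrest)).mono (by omega)
  · simp only [h, decide_false, if_false, Bool.false_eq_true] at hP' ⊢
    exact (Prog.RunsIn.cond_nil (hprep.seq hP') hrest).mono (by omega)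

theorem exists_choices_prog (B : ℕ) : ∃ (C : Prog) (q : Polynomial ℕ),
    ∀ x : ℕ × List (List Lit), C.RunsIn (enc x) (enc (choices B x.1 (lits x.1)))
      (q.eval (esize x) * (choices B x.1 (lits x.1)).length + q.eval (esize x)) := by
  obtain ⟨E, r, hE⟩ := exists_extend_prog B
  have hW : PolyTime (fun x : ℕ × List (List Lit) => lits x.1) := PolyTime.id.fst.lits
  have hinit : PolyTime (fun x : ℕ × List (List Lit) =>
      (lits x.1, (), [(([], x.1) : List Lit × ℕ)])) :=
    hW.pair ((PolyTime.const ()).pair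
      (((PolyTime.const _).pair PolyTime.id.fst).cons (.const [])))
  have hWb := hW.polyBound
  obtain ⟨P, s, hP⟩ := hinit
  let b : ℕ × List (List Lit) → ℕ := fun x => esize (lits x.1) + (2 * esize x + 1) + 1
  have hb : PolyBound b :=
    (hWb.add (((PolyBound.const 2).mul .size).add (.const 1))).add (.const 1)
  obtain ⟨u, hu⟩ : PolyBound (fun x : ℕ × List (List Lit) =>
      esize (lits x.1) * (r.eval (esize (lits x.1) + b x + 1) + 40)) :=
    hWb.mul (PolyBound.add (PolyBound.eval ((hWb.add hb).add (.const 1)) r) (.const 40))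
  obtain ⟨w, hw⟩ : PolyBound (fun x : ℕ × List (List Lit) =>
      s.eval (esize x) + esize (lits x.1) * 40 + 10) :=
    ((PolyBound.size.eval s).add (hWb.mul (.const 40))).add (.const 10)
  refine ⟨.seq (.seq P (Prog.overList (.seq (.pair (.seq .tail .tail) .tail)
    (.seq E (.seq .tail .tail))))) (.seq .tail .tail), u + w, fun x => ?_⟩
  set S := choices B x.1 (lits x.1) with hS
  refine (Prog.RunsIn.seq (t := 3) ((hP x).2.seq (Prog.overList_runsIn
    (T := S.length * (r.eval (esize (lits x.1) + b x + 1) + 40) + 13)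
    (step := fun S x => extend B x S) (g := ()) (lits x.1) [([], x.1)] fun l₁ y l₂ hl => ?_))
    (Prog.RunsIn.seq (s := 1) .tail .tail)).mono ?_
  -- The state after a prefix `l₁` is the enumeration for `l₁`, which is no longer than the full
  -- one.
  · change Prog.RunsIn _ (enc ((), y, choices B x.1 l₁)) (enc (extend B y (choices B x.1 l₁))) _
    have h1 : esize l₁ ≤ esize (lits x.1) := esize_sublist (by rw [hl]; exact List.sublist_append_left _ _)
    have h2 : esize y ≤ esize (lits x.1) := esize_le_of_mem (by rw [hl]; simp)
    have h3 : (choices B x.1 l₁).length ≤ S.length := by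
      rw [hS, hl]; exact length_choices_mono B x.1 l₁ _
    have h4 : 2 * x.1 + 1 ≤ 2 * esize x + 1 := by
      rw [esize_prod, esize_nat]; omega
    have h5 := hE y (choices B x.1 l₁) (b x) fun e he => by
      have := esize_of_mem_choices he
      simp only [b]
      omega
    refine (Prog.RunsIn.seq (s := 5) (t := (choices B x.1 l₁).length *
      (r.eval (esize y + b x + 1) + 40) + 2 + 3 + 1)
      (y := enc (choices B x.1 l₁, y, choices B x.1 l₁))
      (Prog.RunsIn.pair (s := 3) (t := 1) (Prog.RunsIn.seq (s := 1) .tail .tail) .tail)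
      (Prog.RunsIn.seq h5 (Prog.RunsIn.seq (s := 1) (t := 1) .tail .tail))).mono ?_
    have h6 : (choices B x.1 l₁).length * (r.eval (esize y + b x + 1) + 40) ≤
        S.length * (r.eval (esize (lits x.1) + b x + 1) + 40) := by
      gcongr
      exact eval_mono r (by omega)
    omega
  · have h1 := hu x
    have h2 := hw x
    have h3 := length_lt_esize (lits x.1)
    simp only at h1 h2
    simp only [Polynomial.eval_add]
    generalize r.eval (esize (lits x.1) + b x + 1) + 40 = A at *
    generalize u.eval (esize x) = uu at *
    generalize w.eval (esize x) = ww at *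
    have h4 : (lits x.1).length * (S.length * A + 13 + 22) ≤
        esize (lits x.1) * (S.length * A + 13 + 22) := Nat.mul_le_mul_right _ h3.le
    have h5 : esize (lits x.1) * (S.length * A) ≤ uu * S.length := by
      calc _ = esize (lits x.1) * A * S.length := by ring
        _ ≤ _ := Nat.mul_le_mul_right _ h1
    simp only [add_mul]
    have h7 : (lits x.1).length * (S.length * A + 13 + 22) ≤ uu * S.length +
        esize (lits x.1) * 35 := by
      refine h4.trans ?_
      rw [add_assoc, mul_add]
      omega
    have h6 : 0 ≤ ww * S.length := Nat.zero_le _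
    omega

theorem one_le_length_choices (B n : ℕ) (W : List Lit) : 1 ≤ (choices B n W).length :=
  length_choices_mono B n [] W

theorem exists_solve_prog (p : Params) (D B : ℕ) : ∃ (A : Prog) (q : Polynomial ℕ),
    ∀ x : ℕ × List (List Lit), A.RunsIn (enc x) (enc (solve p D B x))
      (q.eval (esize x) * (choices B x.1 (lits x.1)).length) := by
  obtain ⟨C, r, hC⟩ := exists_choices_prog B
  obtain ⟨Q, s, hQ⟩ : PolyTime (fun y : (ℕ × List (List Lit)) × (List Lit × ℕ) ×
      Option (List Bool) => if y.2.2.isSome then y.2.2 else attempt p D y.1 y.2.1.1) :=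
    PolyTime.id.snd.snd.isSome.ite PolyTime.id.snd.snd
      (PolyTime.attempt p D PolyTime.id.fst PolyTime.id.snd.fst.fst)
  obtain ⟨a, ha⟩ : PolyBound (fun y : (ℕ × List (List Lit)) × List Lit =>
      esize (attempt p D y.1 y.2)) :=
    (PolyTime.attempt p D PolyTime.id.fst PolyTime.id.snd).polyBound
  have hW : PolyBound (fun x : ℕ × List (List Lit) => esize (lits x.1)) :=
    PolyTime.id.fst.lits.polyBound
  let b : ℕ × List (List Lit) → ℕ := fun x => esize (lits x.1) + (2 * esize x + 1) + 1
  have hb : PolyBound b :=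
    (hW.add (((PolyBound.const 2).mul .size).add (.const 1))).add (.const 1)
  let c : ℕ × List (List Lit) → ℕ := fun x => a.eval (esize x + b x + 1) + 1
  have hc : PolyBound c := (((PolyBound.size.add hb).add (.const 1)).eval a).add (.const 1)
  obtain ⟨u, hu⟩ : PolyBound (fun x : ℕ × List (List Lit) =>
      2 * r.eval (esize x) + s.eval (esize x + (b x + c x + 1) + 1) + 50) :=
    (((PolyBound.const 2).mul (PolyBound.size.eval r)).add
      (PolyBound.eval ((PolyBound.size.add ((hb.add hc).add (.const 1))).add (.const 1)) s)).add
      (.const 50)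
  refine ⟨.seq (.pair C .skip) (.seq (.pair .head (.pair .tail .nil))
    (.seq (Prog.overList Q) (.seq .tail .tail))), u, fun x => ?_⟩
  set S := choices B x.1 (lits x.1) with hS
  have hCx := hC x
  rw [← hS] at hCx
  refine (Prog.RunsIn.seq (y := enc (S, x)) (hCx.pair .skip)
    (Prog.RunsIn.seq (y := enc (S, x, (none : Option (List Bool)))) (s := 5)
      (Prog.RunsIn.pair (s := 1) (t := 3) .head
        (Prog.RunsIn.pair (s := 1) (t := 1) .tail .nil))
      (Prog.RunsIn.seq (t := 3) (Prog.overList_runsIn (T := s.eval (esize x + (b x + c x + 1) + 1))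
        (step := fun r e => if r.isSome then r else attempt p D x e.1) (g := x) S none
        fun l₁ e l₂ hl => ?_) (Prog.RunsIn.seq (s := 1) (t := 1) .tail .tail)))).mono ?_
  · set acc := l₁.foldl (fun r e => if r.isSome then r else attempt p D x e.1) none with hacc
    have h0 : 2 * x.1 + 1 ≤ 2 * esize x + 1 := by
      rw [esize_prod, esize_nat]; omega
    have hmem : ∀ d ∈ S, esize d ≤ b x := fun d hd => by
      have := esize_of_mem_choices hd
      simp only [b]
      omega
    -- The accumulator is empty or the output of a single attempt, so it does not grow with the
    -- number of sets.
    have h1 : esize acc ≤ c x := by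
      rcases foldl_isSome (f := fun e : List Lit × ℕ => attempt p D x e.1) l₁ with
        ⟨h, -⟩ | ⟨d, hd, -, h⟩
      · rw [hacc, h]; simp [c]
      · rw [hacc, h]
        have h2 := hmem d (by rw [hl]; simp [hd])
        refine ((ha (x, d.1)).trans (eval_mono a ?_)).trans (Nat.le_succ _)
        rw [esize_prod] at h2
        rw [esize_prod]
        simp only
        omega
    refine (hQ (x, e, acc)).2.mono (eval_mono s ?_)
    have h3 := hmem e (by rw [hl]; simp)
    rw [esize_prod (x, e, acc), esize_prod (e, acc)]
    simp only
    omega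
  · have h1 := hu x
    have h2 : 1 ≤ S.length := one_le_length_choices B x.1 _
    simp only at h1
    generalize s.eval (esize x + (b x + c x + 1) + 1) = A at *
    generalize r.eval (esize x) = rr at *
    calc _ = (rr + A + 22) * S.length + (rr + 15) * 1 := by
          ring
      _ ≤ (rr + A + 22) * S.length + (rr + 15) * S.length := by gcongr
      _ = (2 * rr + A + 37) * S.length := by ring
      _ ≤ _ := by gcongr; omega

/-! ### Formulas -/

section Formulas

variable {n : ℕ}

/-- A literal, with the index of its variable as a plain number. -/
def toLit (l : Literal n) : Lit := (l.2, l.1)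

theorem toLit_injective : Function.Injective (toLit (n := n)) := by
  rintro ⟨i, b⟩ ⟨j, c⟩ h
  simp only [toLit, Prod.mk.injEq] at h
  exact Prod.ext (Fin.ext h.2) h.1

/-- The list of clauses with plain numbers as indices. -/
def toLits (F : List (List (Literal n))) : List (List Lit) := F.map fun K => K.map toLit

theorem encodeFormula_eq (F : List (List (Literal n))) :
    encodeFormula F = enc (n, toLits F) := by
  change Data.cons _ _ = Data.cons _ _
  congr 1
  change encodeList _ = encodeList _
  congr 1
  rw [toLits, List.map_map]
  refine List.map_congr_left fun K _ => ?_
  change encodeList _ = encodeList _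
  rw [List.map_map]
  rfl

theorem encodeOutcome_eq (f : ℕ → Bool) :
    enc (some ((List.range n).map f)) = encodeOutcome (some fun i : Fin n => f i) := by
  change Data.cons _ (encodeList _) = Data.cons _ (encodeList _)
  congr 2
  refine List.ext_getElem (by simp) fun i h1 h2 => ?_
  simp
  rfl

theorem mem_lits {v : Lit} : v ∈ lits n ↔ v.2 < n := by
  obtain ⟨b, i⟩ := v
  cases b <;> simp [lits]

theorem length_lits : (lits n).length = 2 * n := by
  simp [lits]; omega

theorem nodup_lits : (lits n).Nodup := by
  refine List.Nodup.append ?_ ?_ ?_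
  · exact List.nodup_range.map fun i j h => by simpa using h
  · exact List.nodup_range.map fun i j h => by simpa using h
  · intro v h1 h2
    simp only [List.mem_map] at h1 h2
    obtain ⟨i, -, rfl⟩ := h1
    obtain ⟨j, -, h⟩ := h2
    simp at h

/-! ### From weights of the hypergraph to numbers of clauses -/

variable {φ : CNF n} {F : List (List (Literal n))}

theorem Writes.countP (h : Writes F φ) (c : Clause n → Prop) [DecidablePred c] :
    F.countP (fun K => decide (c K.toFinset)) = (φ.filter c).card := by
  obtain ⟨-, h2, h3⟩ := h
  rw [← h3, List.filter_toFinset, List.toFinset_card_of_nodup (h2.filter _),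
    ← List.countP_eq_length_filter, List.countP_map]
  rfl

theorem Writes.length (h : Writes F φ) : F.length = φ.card := by
  rw [← h.2.2, List.toFinset_card_of_nodup h.2.1, List.length_map]

theorem Writes.mem (h : Writes F φ) {K : List (Literal n)} (hK : K ∈ F) : K.toFinset ∈ φ := by
  rw [← h.2.2]
  exact List.mem_toFinset.2 (List.mem_map.2 ⟨K, hK, rfl⟩)

theorem neg_injective : Function.Injective (Literal.neg (n := n)) := by
  rintro ⟨i, b⟩ ⟨j, c⟩ h
  simpa [Literal.neg] using h

/-- Negation is injective on literals and all clauses have size `k`, so weights of edges are numbers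
of clauses times `p ^ k`. Testing against the negation of `L` undoes the negation in the edges. -/
theorem pWeight_filter {k : ℕ} (hφ : IsKSAT k φ) (p : ℝ) (L : Finset (Literal n)) :
    pWeight p (φ.hypergraph.edges.filter fun E => L.image Literal.neg ⊆ E) =
      (φ.filter fun K => L ⊆ K).card * p ^ k := by
  rw [pWeight, CNF.hypergraph, Finset.filter_image,
    Finset.sum_image fun K _ K' _ h => Finset.image_injective neg_injective h]
  simp only [Finset.image_subset_image_iff neg_injective]
  rw [Finset.sum_congr rfl (g := fun _ => p ^ k) fun K hK => ?_, Finset.sum_const, nsmul_eq_mul]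
  rw [Finset.card_image_of_injective _ neg_injective, hφ K (Finset.mem_filter.1 hK).1]

theorem avgWeight_eq {k : ℕ} (hφ : IsKSAT k φ) (p : ℝ) :
    avgWeight p φ.hypergraph = φ.card * p ^ k / (n * 2) := by
  have h := pWeight_filter hφ p ∅
  simp only [Finset.image_empty, Finset.empty_subset, Finset.filter_true] at h
  rw [avgWeight, h]
  simp

theorem card_filter_le_maxCodegree {k : ℕ} (hφ : IsKSAT k φ) (p : ℝ) (L : Finset (Literal n)) :
    (φ.filter fun K => L ⊆ K).card * p ^ k ≤ maxCodegree L.card p φ.hypergraph := by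
  rw [← pWeight_filter hφ]
  exact le_ciSup (f := fun M : {M : Finset (Literal n) // M.card = L.card} =>
    pWeight p (φ.hypergraph.edges.filter fun E => M.1 ⊆ E)) (Set.finite_range _).bddAbove
    ⟨L.image Literal.neg, Finset.card_image_of_injective _ neg_injective⟩

theorem card_filter_pair_le {k : ℕ} (hφ : IsKSAT k φ) {lam p : ℝ} (hp : 0 < p)
    (h : IsSpreadStructure lam p k φ.hypergraph) (hn : 0 < n) {a b : Literal n} (hab : a ≠ b) :
    ((φ.filter fun K => {a, b} ⊆ K).card : ℝ) * (n * 2) ≤ lam * φ.card * p ^ k := by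
  have h1 := (card_filter_le_maxCodegree hφ p {a, b})
  rw [Finset.card_pair hab] at h1
  have h2 := h1.trans h.codegree_two_le
  have h3 := le_of_mul_le_mul_right h2 (by positivity)
  rw [avgWeight_eq hφ, mul_div_assoc'] at h3
  rw [le_div_iff₀ (by positivity)] at h3
  linarith

theorem card_filter_single_le {k : ℕ} (hφ : IsKSAT k φ) {lam p : ℝ} (hp : 0 < p)
    (h : IsSpreadStructure lam p k φ.hypergraph) (hn : 0 < n) (a : Literal n) :
    ((φ.filter fun K => {a} ⊆ K).card : ℝ) * (n * 2) ≤ lam * φ.card := by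
  have h1 := (card_filter_le_maxCodegree hφ p {a})
  rw [Finset.card_singleton] at h1
  have h2 := h1.trans h.codegree_one_le
  rw [avgWeight_eq hφ, mul_div_assoc', le_div_iff₀ (by positivity)] at h2
  refine le_of_mul_le_mul_right (a := p ^ k) ?_ (by positivity)
  linarith

/-- If `n = 0` or there are no clauses, the average weight is `0` (for `n = 0` through division by
zero), which is less than `p`. -/
theorem pos_of_spread {k : ℕ} (hφ : IsKSAT k φ) {lam p : ℝ} (hp : 0 < p)
    (h : IsSpreadStructure lam p k φ.hypergraph) : 0 < n ∧ 0 < φ.card := by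
  have h1 := h.avg_ge
  rw [avgWeight_eq hφ] at h1
  constructor <;> refine Nat.pos_of_ne_zero fun h0 => ?_
  · have h2 : (n : ℝ) = 0 := by exact_mod_cast h0
    rw [h2, zero_mul, div_zero] at h1
    linarith
  · rw [h0, Nat.cast_zero, zero_mul, zero_div] at h1
    linarith

/-- The clauses of a spread formula have the properties that the container procedure needs. -/
theorem spread_toLits {q : Params} {Λ : ℕ} (hφ : IsKSAT q.k φ) {lam p : ℝ} (hp : 0 < p)
    (h : IsSpreadStructure lam p q.k φ.hypergraph) (hF : Writes F φ) (hk : 1 ≤ q.k)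
    (hlam : lam ≤ Λ) (hΛ : 1 ≤ Λ) (hK : 0 < q.K) (hpK : p ≤ 1 / (Λ * q.K)) :
    Spread q (toLits F).length n Λ (lits n).toFinset (toLits F) := by
  obtain ⟨hn, hm⟩ := pos_of_spread hφ hp h
  have hlen : (toLits F).length = φ.card := by rw [toLits, List.length_map, hF.length]
  have hcount : ∀ (c : List Lit → Bool) (A : Finset (Literal n)),
      (∀ K ∈ F, c (K.map toLit) → A ⊆ K.toFinset) →
      (toLits F).countP c ≤ (φ.filter fun K => A ⊆ K).card := by
    intro c A hc
    rw [← hF.countP, toLits, List.countP_map]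
    exact List.countP_mono_left fun K hK h => decide_eq_true (hc K hK h)
  refine Spread.initial ?_ ?_ ?_ ?_ ?_
  · intro E hE
    obtain ⟨K, hK, rfl⟩ := List.mem_map.1 hE
    exact (hF.1 K hK).map toLit_injective
  · intro E hE u hu
    obtain ⟨K, hK, rfl⟩ := List.mem_map.1 hE
    obtain ⟨l, -, rfl⟩ := List.mem_map.1 hu
    exact List.mem_toFinset.2 (mem_lits.2 l.1.2)
  · intro E hE
    obtain ⟨K, hK, rfl⟩ := List.mem_map.1 hE
    rw [List.length_map, ← List.toFinset_card_of_nodup (hF.1 K hK)]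
    exact hφ _ (hF.mem hK)
  · intro u
    rw [hlen]
    by_cases hu : u.2 < n
    · have h1 := hcount (fun E => decide (u ∈ E)) {(⟨u.2, hu⟩, u.1)} fun K _ hc => by
        obtain ⟨l, hl, hlu⟩ := List.mem_map.1 (of_decide_eq_true hc)
        have : l = (⟨u.2, hu⟩, u.1) := toLit_injective hlu
        simpa [← this] using hl
      have h2 := card_filter_single_le hφ hp h hn (⟨u.2, hu⟩, u.1)
      have h3 : lam * φ.card ≤ Λ * φ.card := by gcongr
      have h4 := (h2.trans h3)
      norm_cast at h4
      nlinarith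
    · have : (toLits F).countP (fun E => decide (u ∈ E)) = 0 := by
        refine List.countP_eq_zero.2 fun E hE hc => ?_
        obtain ⟨K, hK, rfl⟩ := List.mem_map.1 hE
        obtain ⟨l, hl, rfl⟩ := List.mem_map.1 (of_decide_eq_true hc)
        exact hu l.1.2
      simp [this]
  · intro u v huv
    rw [hlen]
    by_cases huvn : u.2 < n ∧ v.2 < n
    · obtain ⟨hu, hv⟩ := huvn
      have hne : ((⟨u.2, hu⟩, u.1) : Literal n) ≠ (⟨v.2, hv⟩, v.1) := by
        intro h
        simp only [Prod.mk.injEq, Fin.mk.injEq] at h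
        exact huv (Prod.ext h.2 h.1)
      have h1 := hcount (fun E => decide (u ∈ E) && decide (v ∈ E))
        {(⟨u.2, hu⟩, u.1), (⟨v.2, hv⟩, v.1)} fun K _ hc => by
          simp only [Bool.and_eq_true, decide_eq_true_eq] at hc
          obtain ⟨l, hl, hlu⟩ := List.mem_map.1 hc.1
          obtain ⟨l', hl', hlv⟩ := List.mem_map.1 hc.2
          have e1 : l = (⟨u.2, hu⟩, u.1) := toLit_injective hlu
          have e2 : l' = (⟨v.2, hv⟩, v.1) := toLit_injective hlv
          intro x hx
          rw [← e1, ← e2] at hx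
          rcases Finset.mem_insert.1 hx with rfl | hx
          · simpa using hl
          · rw [Finset.mem_singleton.1 hx]; simpa using hl'
      have h2 := card_filter_pair_le hφ hp h hn hne
      set N := (φ.filter fun K => {((⟨u.2, hu⟩, u.1) : Literal n), (⟨v.2, hv⟩, v.1)} ⊆ K).card
      have hΛ' : (1 : ℝ) ≤ Λ := by exact_mod_cast hΛ
      have hK' : (0 : ℝ) < q.K := by exact_mod_cast hK
      -- From `p K ≤ 1 / Λ` one gets `(p K) ^ k ≤ 1 / Λ`, and this absorbs the factor `lam ≤ Λ`. It
      -- is the only place where `p` has to be small.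
      have h3 : lam * φ.card * p ^ q.k * q.K ^ q.k ≤ φ.card := by
        have h4 : (p * q.K) ^ q.k ≤ (1 / Λ : ℝ) ^ q.k := by
          gcongr
          calc p * q.K ≤ 1 / (Λ * q.K) * q.K := by gcongr
            _ = 1 / Λ := by field_simp
        have h5 : (1 / Λ : ℝ) ^ q.k ≤ 1 / Λ :=
          pow_le_of_le_one (by positivity) (by rw [div_le_one (by positivity)]; exact hΛ') (by omega)
        calc lam * φ.card * p ^ q.k * q.K ^ q.k = lam * φ.card * (p * q.K) ^ q.k := by
              rw [mul_pow]; ring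
          _ ≤ Λ * φ.card * (p * q.K) ^ q.k := by gcongr
          _ ≤ Λ * φ.card * (1 / Λ) := by gcongr; exact h4.trans h5
          _ = φ.card := by field_simp
      have h6 : (N : ℝ) * q.K ^ q.k * (n * 2) ≤ φ.card := by
        calc (N : ℝ) * q.K ^ q.k * (n * 2) = N * (n * 2) * q.K ^ q.k := by ring
          _ ≤ lam * φ.card * p ^ q.k * q.K ^ q.k := by gcongr
          _ ≤ _ := h3
      norm_cast at h6
      calc _ ≤ N * q.K ^ q.k * n := by gcongr
        _ ≤ N * q.K ^ q.k * (n * 2) := by gcongr; omega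
        _ ≤ _ := h6
    · have : (toLits F).countP (fun E => decide (u ∈ E) && decide (v ∈ E)) = 0 := by
        refine List.countP_eq_zero.2 fun E hE hc => huvn ?_
        simp only [Bool.and_eq_true, decide_eq_true_eq] at hc
        obtain ⟨K, hK, rfl⟩ := List.mem_map.1 hE
        obtain ⟨l, -, rfl⟩ := List.mem_map.1 hc.1
        obtain ⟨l', -, rfl⟩ := List.mem_map.1 hc.2
        exact ⟨l.1.2, l'.1.2⟩
      simp [this]

/-! ### Satisfying assignments as oracles, and the quality of the output -/

theorem volume_le {L : List (List Lit)} {k : ℕ} (h : ∀ e ∈ L, e.length ≤ k) :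
    volume L ≤ k * L.length := by
  induction L with
  | nil => simp [volume]
  | cons e L ih =>
    have h1 := ih fun d hd => h d (by simp [hd])
    have h2 := h e (by simp)
    simp only [volume, List.map_cons, List.sum_cons, List.length_cons, mul_add] at h1 ⊢
    omega

/-- If the formula is satisfiable, then one of the attempts succeeds. -/
theorem exists_attempt {q : Params} {Λ B D : ℕ} (hF : Writes F φ) (hn : 0 < n) (hm : 0 < φ.card)
    (hΛ : 2 ≤ Λ) (hk : 1 ≤ q.k) (hD : 1 ≤ D)
    (hR : q.R = 2 * q.k ^ 2 * (Λ * q.k) ^ q.k * D) (hK : q.K = 4 * q.k * Λ * q.R * B + 1)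
    (hS : Spread q (toLits F).length n Λ (lits n).toFinset (toLits F)) (hsat : Satisfiable φ) :
    ∃ e ∈ choices B n (lits n), attempt q D (n, toLits F) e.1 ≠ none := by
  obtain ⟨a, ha⟩ := hsat
  -- The literals that `a` falsifies.
  let I : Lit → Prop := fun l => ∃ h : l.2 < n, a ⟨l.2, h⟩ ≠ l.1
  have hlen : (toLits F).length = φ.card := by rw [toLits, List.length_map, hF.length]
  have hI : ∀ E ∈ toLits F, ∃ u ∈ E, ¬ I u := by
    intro E hE
    obtain ⟨K, hK, rfl⟩ := List.mem_map.1 hE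
    obtain ⟨l, hl, hal⟩ := ha _ (hF.mem hK)
    exact ⟨toLit l, List.mem_map.2 ⟨l, List.mem_toFinset.1 hl, rfl⟩, fun ⟨_, h⟩ => h hal⟩
  obtain ⟨G, hG, hO⟩ := exists_fingerprint (W := lits n) (B := B) (D := D)
    (T := q.k * (toLits F).length) (by omega) hn hΛ hk hD length_lits.le hR hK hS hI
    (volume_le hS.length_le)
  have hcard : (lits n).countP (fun v => decide (v ∈ G)) ≤ G.card := by
    rw [List.countP_eq_length_filter, ← List.toFinset_card_of_nodup (nodup_lits.filter _)]
    refine Finset.card_le_card fun v hv => ?_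
    simpa using (List.mem_filter.1 (List.mem_toFinset.1 hv)).2
  refine ⟨_, mem_choices (c := fun v => decide (v ∈ G)) (B := B)
    ((Nat.mul_le_mul_right _ hcard).trans hG), ?_⟩
  -- The enumeration produces only sublists of `lits n`. Restricting `G` to them is harmless, since
  -- the oracle matters on `lits n` alone.
  obtain ⟨h1, h2⟩ := hO (fun v => decide (v ∈ ((lits n).filter fun v => decide (v ∈ G)).reverse))
    fun v hv => by simp [hv]
  change ∀ u ∈ recorded q (n, toLits F) _, ¬ I u at h1
  change (toLits F).countP (fun E => decide (∀ u ∈ E, u ∉ recorded q (n, toLits F) _)) * D ≤ _ at h2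
  simp only
  generalize ((lits n).filter fun v => decide (v ∈ G)).reverse = G' at h1 h2 ⊢
  have h3 : violated (recorded q (n, toLits F) G') (toLits F) * D ≤ (toLits F).length := by
    refine le_trans ?_ h2
    gcongr
    refine List.countP_mono_left fun E hE hc => ?_
    obtain ⟨K, hK, rfl⟩ := List.mem_map.1 hE
    rw [List.all_eq_true] at hc
    refine decide_eq_true fun u hu hux => ?_
    have h4 := hc u hu
    obtain ⟨l, hl, rfl⟩ := List.mem_map.1 hu
    obtain ⟨i, b⟩ := l
    have h5 := h1 _ hux
    cases b with
    | true =>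
      exact bne_iff_ne.1 h4 (decide_eq_true hux)
    | false =>
      -- A violated clause with the recorded negative literal of `i` would force the positive one to
      -- be recorded as well, yet recorded literals are true under `a`.
      have h6 : ((true, (i : ℕ)) : Lit) ∈ recorded q (n, toLits F) G' :=
        of_decide_eq_true (Bool.eq_true_of_not_eq_false (bne_iff_ne.1 h4))
      refine h1 _ h6 ⟨i.2, fun h7 => h5 ⟨i.2, fun h8 => ?_⟩⟩
      have h9 : a i = true := h7
      have h10 : a i = false := h8
      rw [h9] at h10
      simp at h10
  rw [attempt, if_pos (decide_eq_true h3)]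
  simp

/-- A successful attempt yields an assignment that satisfies most clauses. -/
theorem isCorrectOutcome_of_violated {δ : ℝ} {D : ℕ} (hF : Writes F φ) (hδ : 0 < δ)
    (hD : 1 / δ ≤ D) {X : List Lit} (h : violated X (toLits F) * D ≤ (toLits F).length) :
    IsCorrectOutcome δ φ (some fun i : Fin n => decide (((true, (i : ℕ)) : Lit) ∈ X)) := by
  set a : Fin n → Bool := fun i => decide (((true, (i : ℕ)) : Lit) ∈ X) with ha
  have hlen : (toLits F).length = φ.card := by rw [toLits, List.length_map, hF.length]
  have h1 : violated X (toLits F) = (φ.filter fun K => ¬ SatisfiesClause a K).card := by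
    rw [← hF.countP, violated, toLits, List.countP_map]
    refine List.countP_congr fun K _ => ?_
    simp only [Function.comp, List.all_eq_true, decide_eq_true_eq, SatisfiesClause, not_exists,
      not_and, List.mem_toFinset, List.forall_mem_map]
    refine forall₂_congr fun l _ => ?_
    rw [bne_iff_ne]
    rfl
  have h2 := Finset.card_filter_add_card_filter_not (s := φ) (SatisfiesClause a)
  rw [h1, hlen] at h
  change (1 - δ) * φ.card ≤ ((φ.filter (SatisfiesClause a)).card : ℝ)
  have h3 : ((φ.filter fun K => ¬ SatisfiesClause a K).card : ℝ) * D ≤ φ.card := by exact_mod_cast h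
  have h4 : ((φ.filter (SatisfiesClause a)).card : ℝ) +
      (φ.filter fun K => ¬ SatisfiesClause a K).card = φ.card := by exact_mod_cast h2
  set u : ℝ := ((φ.filter fun K => ¬ SatisfiesClause a K).card : ℝ)
  have hu : 0 ≤ u := Nat.cast_nonneg _
  have h5 : u * (1 / δ) ≤ φ.card := (mul_le_mul_of_nonneg_left hD hu).trans h3
  have h6 : u ≤ δ * φ.card := by
    rw [mul_one_div, div_le_iff₀ hδ] at h5
    linarith
  linarith

theorem card_le_of_isKSAT {k : ℕ} (hφ : IsKSAT k φ) : φ.card ≤ (2 * n) ^ k := by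
  have h1 : φ ⊆ Finset.powersetCard k Finset.univ := fun K hK =>
    Finset.mem_powersetCard.2 ⟨Finset.subset_univ _, hφ K hK⟩
  refine (Finset.card_le_card h1).trans ?_
  rw [Finset.card_powersetCard]
  refine (Nat.choose_le_pow _ _).trans (le_of_eq ?_)
  simp [mul_comm]

/-- The size of the input is polynomial in the number of variables. -/
theorem exists_size_bound (k : ℕ) : ∃ q : Polynomial ℕ, ∀ (n : ℕ) (φ : CNF n), IsKSAT k φ →
    ∀ F, Writes F φ → esize (n, toLits F) ≤ q.eval n := by
  refine ⟨(2 * .X + 1) + ((2 * .X) ^ k * (.C k * (2 * .X + 6) + 2) + 1) + 1, fun n φ hφ F hF => ?_⟩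
  simp only [Polynomial.eval_add, Polynomial.eval_mul, Polynomial.eval_pow, Polynomial.eval_X,
    Polynomial.eval_C, Polynomial.eval_ofNat, Polynomial.eval_one]
  rw [esize_prod, esize_nat]
  have h1 : ∀ E ∈ toLits F, esize E ≤ k * (2 * n + 6) + 1 := by
    intro E hE
    obtain ⟨K, hK, rfl⟩ := List.mem_map.1 hE
    have h2 : (K.map toLit).length = k := by
      rw [List.length_map, ← List.toFinset_card_of_nodup (hF.1 K hK)]
      exact hφ _ (hF.mem hK)
    rw [← h2]
    refine esize_list_le (B := 2 * n + 5) fun l hl => ?_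
    obtain ⟨l, -, rfl⟩ := List.mem_map.1 hl
    have h3 := esize_bool_le l.2
    have h4 := l.1.2
    rw [esize_prod, toLit, esize_nat]
    simp only
    omega
  have h2 := esize_list_le h1
  have h3 : (toLits F).length ≤ (2 * n) ^ k := by
    rw [toLits, List.length_map, hF.length]
    exact card_le_of_isKSAT hφ
  have h4 : (toLits F).length * (k * (2 * n + 6) + 1 + 1) ≤
      (2 * n) ^ k * (k * (2 * n + 6) + 2) := by gcongr
  simp only
  omega

end Formulas

/-- For a suitable price of the members, there are at most `2 ^ (ε n)` small sets. -/
theorem exists_price {ε : ℝ} (hε : 0 < ε) : ∃ B : ℕ, ∀ n : ℕ,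
    ((choices B n (lits n)).length : ℝ) ≤ 2 ^ (ε * n) := by
  set θ : ℝ := 2 ^ (ε / 2) with hθ
  have hθ1 : 1 < θ := Real.one_lt_rpow (by norm_num) (by positivity)
  have h1 : (1 : ℝ) < 2 ^ (ε / 4) := Real.one_lt_rpow (by norm_num) (by positivity)
  -- `θ ^ n` uses half of the exponent `ε n`, and the `2 n` factors `1 + θ ^ (-B) ≤ 2 ^ (ε / 4)` use
  -- the other half.
  obtain ⟨B, hB⟩ := exists_pow_lt_of_lt_one (sub_pos.2 h1) (inv_lt_one_of_one_lt₀ hθ1)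
  refine ⟨B, fun n => (length_choices_le hθ1.le B n _).trans ?_⟩
  rw [length_lits]
  have h2 : 1 + (θ ^ B)⁻¹ ≤ 2 ^ (ε / 4) := by
    rw [← inv_pow]; linarith
  calc θ ^ n * (1 + (θ ^ B)⁻¹) ^ (2 * n) ≤ θ ^ n * (2 ^ (ε / 4)) ^ (2 * n) := by gcongr
    _ = 2 ^ (ε * n) := by
      rw [hθ, ← Real.rpow_natCast, ← Real.rpow_natCast, ← Real.rpow_mul (by norm_num),
        ← Real.rpow_mul (by norm_num), ← Real.rpow_add (by norm_num)]
      congr 1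
      push_cast
      ring

end SpreadSAT

theorem theorem1p3 (k : ℕ) (hk : 1 < k) (lam : ℝ) (hlam : 1 < lam) (δ : ℝ) (hδ₀ : 0 < δ)
    (hδ : δ < 1 / 4) (ε : ℝ) (hε : 0 < ε) :
    ∃ p' : ℝ, 0 < p' ∧ p' ≤ 1 ∧
      ∃ (A : Prog) (q : Polynomial ℕ),
        ∀ p : ℝ, 0 < p → p < p' →
          ∀ (n : ℕ) (φ : CNF n), IsKSAT k φ → IsSpreadStructure lam p k (CNF.hypergraph φ) →
            ∀ F : List (List (Literal n)), Writes F φ →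
              ∃ (out : Option (Fin n → Bool)) (t : ℕ),
                A.Runs (encodeFormula F) (encodeOutcome out) t ∧
                (t : ℝ) ≤ (q.eval n : ℕ) * (2 : ℝ) ^ (ε * n) ∧
                IsCorrectOutcome δ φ out := by
  obtain ⟨B, hB⟩ := exists_price hε
  obtain ⟨Λ, hΛlam⟩ : ∃ Λ : ℕ, lam ≤ Λ := exists_nat_ge lam
  have hΛ : 2 ≤ Λ := by
    have : (1 : ℝ) < Λ := hlam.trans_le hΛlam
    exact_mod_cast this
  obtain ⟨D, hD⟩ : ∃ D : ℕ, 1 / δ ≤ D := exists_nat_ge _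
  have hD1 : 1 ≤ D := by
    have : (0 : ℝ) < D := lt_of_lt_of_le (by positivity) hD
    exact_mod_cast this
  -- The constants are chosen without circularity: `B` from `ε`, `Λ` from `lam` and `D` from `δ`,
  -- then `R` for few surviving clauses, `K` for few yes answers, and finally `p' = 1 / (Λ K)` for
  -- the codegrees.
  set R := 2 * k ^ 2 * (Λ * k) ^ k * D with hR
  set K := 4 * k * Λ * R * B + 1 with hK
  set P : Params := ⟨k, K, R⟩ with hP
  have hΛK : (1 : ℝ) ≤ Λ * K := by
    have : 1 ≤ Λ * K := Nat.mul_pos (by omega) (by omega)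
    exact_mod_cast this
  obtain ⟨A, q, hA⟩ := exists_solve_prog P D B
  obtain ⟨r, hr⟩ := exists_size_bound k
  refine ⟨1 / (Λ * K), by positivity, ?_, A, q.comp r, fun p hp hpp n φ hφ hS F hF => ?_⟩
  · rw [div_le_one (by positivity)]; exact hΛK
  obtain ⟨hn, hm⟩ := pos_of_spread hφ hp hS
  have hSp : Spread P (toLits F).length n Λ (lits n).toFinset (toLits F) :=
    spread_toLits (q := P) hφ hp hS hF hk.le hΛlam (by omega) (Nat.succ_pos _) hpp.le
  obtain ⟨t, ht, hrun⟩ := hA (n, toLits F)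
  have htime : (t : ℝ) ≤ ((q.comp r).eval n : ℕ) * (2 : ℝ) ^ (ε * n) := by
    have h1 : (t : ℝ) ≤ (q.eval (esize (n, toLits F)) : ℕ) * ((choices B n (lits n)).length : ℝ) := by
      exact_mod_cast ht
    refine h1.trans ?_
    rw [Polynomial.eval_comp]
    have h2 := eval_mono q (hr n φ hφ F hF)
    gcongr
    exact hB n
  rw [encodeFormula_eq]
  rcases foldl_isSome (f := fun e : List Lit × ℕ => attempt P D (n, toLits F) e.1)
    (choices B n (lits n)) with ⟨h1, h2⟩ | ⟨e, he, h1, h2⟩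
  · refine ⟨none, t, ?_, htime, fun hsat => ?_⟩
    · change solve P D B (n, toLits F) = none at h1
      rw [h1] at hrun
      exact hrun
    · obtain ⟨e, he, hne⟩ := exists_attempt (q := P) hF hn hm hΛ hk.le hD1 hR hK hSp hsat
      exact hne (h2 e he)
  · change solve P D B (n, toLits F) = attempt P D (n, toLits F) e.1 at h2
    rw [h2] at hrun
    simp only [attempt] at h1 hrun
    split_ifs at h1 hrun with h3
    · rw [encodeOutcome_eq] at hrun
      exact ⟨_, t, hrun, htime, isCorrectOutcome_of_violated hF hδ₀ hD (of_decide_eq_true h3)⟩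
    · exact absurd rfl h1
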